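/- For $n\in\mathbb{N}$ and $p\in[0,1]$ let $[n]_p$ be the random subset of $[n]=\{1,\dots,n\}$ that contains each element with probability $p$, independently of the others. For $\ell\ge 3$ let $X_\ell=X_\ell(n)$ be the number of arithmetic progressions $\{a,a+b,\dots,a+(\ell-1)b\}\subseteq[n]$ with common difference $b\ge 1$ that are contained in $[n]_p$, and let $\sigma_\ell:=\sqrt{\mathrm{Var}(X_\ell)}$. Let either $\ell\ge 3$ be a constant, or $\ell=\ell(n)$ be a sequence of integers with $\ell\to\infty$ and $\ell/\log n\to 0$ as $n\to\infty$; and let $p=p(n)\in(0,1]$ with $p\to 0$ as $n\to\infty$. Then, as $n\to\infty$: (a) if $n^2p^{\ell}/(\ell-1)\to c$ for some real $c\ge 0$, then $X_\ell$ converges in distribution to the Poisson distribution $\mathrm{Po}(c/2)$ with mean $c/2$ (where $\mathrm{Po}(0)$ is the point mass at $0$); (b) if $n^2p^{\ell}/(\ell-1)\to+\infty$, then $(X_\ell-\mathbb{E}(X_\ell))/\sigma_\ell$ converges in distribution to the standard normal distribution $\mathrm{N}(0,1)$. -/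

import Mathlib

noncomputable section

namespace RandomAP

/-- `T` is (the set of terms of) an arithmetic progression `a, a + b, …, a + (ℓ - 1) b` of length
`ℓ` with common difference `b ≥ 1`. -/
def IsAP (ℓ : ℕ) (T : Finset ℕ) : Prop :=
  ∃ a b : ℕ, 0 < b ∧ T = (Finset.range ℓ).image (fun i => a + i * b)

open Classical in
/-- The set of all `ℓ`-APs contained in `[n] = {1, …, n}`. -/
def apSet (ℓ n : ℕ) : Finset (Finset ℕ) :=
  {T ∈ (Finset.Icc 1 n).powerset | IsAP ℓ T}

open Classical in
/-- The number of `ℓ`-APs in `[n]` all of whose terms lie in `S`. -/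
def numAP (ℓ n : ℕ) (S : Set ℕ) : ℕ :=
  ∑ T ∈ apSet ℓ n, if (T : Set ℕ) ⊆ S then 1 else 0

/-- The law of the binomial random subset `[n]_p`: each element of `{1, …, n}` is included with
probability `p`, independently of one another, and no other number is included. -/
abbrev randomSubset (n : ℕ) (p : unitInterval) : MeasureTheory.Measure (Set ℕ) :=
  ProbabilityTheory.setBernoulli (Set.Icc 1 n) p

end RandomAP

end

/-!
Differentiating the characteristic function `φ` of a sum of locally dependent variables produces one
term per summand, and replacing the sum inside that term by its part independent of the summand
shows that `φ` almost solves the linear equation satisfied by the Poisson characteristic function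
(for containment indicators, when overlapping pairs have small total weight) or by the Gaussian one
(for the normalised sum, when the weight of the triples `a, b, c` with `b` and `c` meeting `a` is
small compared with `σ ^ 3`). An almost-solution of a linear equation is close to the solution.

For progressions, a point lies in `O(n)` of them while two points lie in at most `ℓ ^ 2`, so the
overlaps in a single point dominate and have weight about `D = 2 ℓ n p ^ (ℓ - 1)` per progression.
With `μ` the mean, the Poisson error is of order `μ (D + p)`, and the Gaussian one of order
`μ (D + 1) ^ 2 / σ ^ 3`. The latter vanishes because `σ ^ 2` is bounded below both by a multiple of
`μ` and by a multiple of `n ^ 3 p ^ (2 ℓ - 1)`: the covariance of two progressions grows at least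
linearly in the size of their intersection, and by Cauchy–Schwarz these sizes add up to at least
their value for a family covering all points evenly.
-/

open MeasureTheory ProbabilityTheory Filter Topology

namespace RandomAP

section CharacteristicFunctions

open Complex

lemma norm_sub_cexp_le_of_hasDerivAt {φ φ' g g' : ℝ → ℂ} (hφ : ∀ s, HasDerivAt φ (φ' s) s)
    (hg : ∀ s, HasDerivAt g (g' s) s) (hφ0 : φ 0 = 1) (hg0 : g 0 = 0) {t ε L : ℝ}
    (hε : ∀ s ∈ Set.uIcc 0 t, ‖φ' s - g' s * φ s‖ ≤ ε)
    (hL : ∀ s ∈ Set.uIcc 0 t, ‖cexp (g t - g s)‖ ≤ L) :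
    ‖φ t - cexp (g t)‖ ≤ ε * L * |t| := by
  have hd (s : ℝ) : HasDerivAt (fun s => φ s * cexp (g t - g s))
      ((φ' s - g' s * φ s) * cexp (g t - g s)) s :=
    ((hφ s).mul ((hg s).const_sub (g t)).cexp).congr_deriv (by ring)
  have hbound : ∀ s ∈ Set.uIcc 0 t, ‖(φ' s - g' s * φ s) * cexp (g t - g s)‖ ≤ ε * L :=
    fun s hs => (norm_mul _ _).trans_le <| mul_le_mul (hε s hs) (hL s hs) (norm_nonneg _)
      ((norm_nonneg _).trans (hε s hs))
  simpa [hφ0, hg0] using (convex_uIcc (0 : ℝ) t).norm_image_sub_le_of_norm_hasDerivWithin_le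
    (fun s _ => (hd s).hasDerivWithinAt) hbound Set.left_mem_uIcc Set.right_mem_uIcc

lemma norm_cexp_mul_I_sub_one_le (x : ℝ) : ‖cexp (x * I) - 1‖ ≤ |x| := by
  simpa [mul_comm] using Real.norm_exp_I_mul_ofReal_sub_one_le (x := x)

lemma hasDerivAt_cexp_mul_I (x : ℝ) :
    HasDerivAt (fun y : ℝ => cexp (y * I)) (I * cexp (x * I)) x := by
  have h : HasDerivAt (fun y : ℝ => (y : ℂ) * I) I x := by
    simpa using (hasDerivAt_id x).ofReal_comp.mul_const I
  simpa [mul_comm] using h.cexp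

lemma norm_cexp_mul_I_sub_one_sub_le (x : ℝ) : ‖cexp (x * I) - 1 - x * I‖ ≤ x ^ 2 := by
  have hd (y : ℝ) : HasDerivAt (fun y : ℝ => cexp (y * I) - 1 - y * I)
      (I * (cexp (y * I) - 1)) y := by
    have h : HasDerivAt (fun y : ℝ => (y : ℂ) * I) I y := by
      simpa using (hasDerivAt_id y).ofReal_comp.mul_const I
    exact (((hasDerivAt_cexp_mul_I y).sub_const 1).sub h).congr_deriv (by ring)
  have hbound : ∀ y ∈ Set.uIcc 0 x, ‖I * (cexp (y * I) - 1)‖ ≤ |x| := fun y hy => by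
    rw [norm_mul, norm_I, one_mul]
    exact (norm_cexp_mul_I_sub_one_le y).trans (by simpa using Set.abs_sub_left_of_mem_uIcc hy)
  simpa [← sq_abs x, sq] using (convex_uIcc (0 : ℝ) x).norm_image_sub_le_of_norm_hasDerivWithin_le
    (fun y _ => (hd y).hasDerivWithinAt) hbound Set.left_mem_uIcc Set.right_mem_uIcc

variable {Ω : Type*} [MeasurableSpace Ω] {P : Measure Ω} {c U V : Ω → ℝ}

/-- The characteristic function of the random variable `U` weighted by the random variable `c`.
For `c = 1` it is the characteristic function of `U`, see `charFun_map_eq_weightedCharFun`. -/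
noncomputable def weightedCharFun (P : Measure Ω) (c U : Ω → ℝ) (t : ℝ) : ℂ :=
  ∫ ω, c ω * cexp ((t * U ω : ℝ) * I) ∂P

lemma charFun_map_eq_weightedCharFun (hU : AEMeasurable U P) (t : ℝ) :
    charFun (P.map U) t = weightedCharFun P (fun _ => 1) U t := by
  rw [charFun_apply_real, integral_map hU (by fun_prop)]
  simp [weightedCharFun]

lemma integrable_mul_cexp_mul_I (hc : Integrable c P) (hU : AEMeasurable U P) (t : ℝ) :
    Integrable (fun ω => c ω * cexp ((t * U ω : ℝ) * I)) P :=
  hc.ofReal.mul_bdd (c := 1) (by fun_prop)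
    (Eventually.of_forall fun _ => (norm_exp_ofReal_mul_I _).le)

lemma weightedCharFun_sum {ι : Type*} {s : Finset ι} {c : ι → Ω → ℝ}
    (hc : ∀ i ∈ s, Integrable (c i) P) (hU : AEMeasurable U P) (t : ℝ) :
    weightedCharFun P (fun ω => ∑ i ∈ s, c i ω) U t = ∑ i ∈ s, weightedCharFun P (c i) U t := by
  unfold weightedCharFun
  rw [← integral_finsetSum _ fun i hi => integrable_mul_cexp_mul_I (hc i hi) hU t]
  simp only [ofReal_sum, Finset.sum_mul]

lemma weightedCharFun_add_const (c U : Ω → ℝ) (a t : ℝ) :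
    weightedCharFun P c (fun ω => U ω + a) t
      = cexp ((t * a : ℝ) * I) * weightedCharFun P c U t := by
  unfold weightedCharFun
  rw [← integral_const_mul]
  congr 1 with ω
  rw [mul_left_comm, ← Complex.exp_add]
  push_cast
  ring_nf

lemma weightedCharFun_of_indepFun (hcU : IndepFun c U P) (hc : AEMeasurable c P)
    (hU : AEMeasurable U P) (t : ℝ) :
    weightedCharFun P c U t = (∫ ω, c ω ∂P : ℝ) * charFun (P.map U) t := by
  rw [charFun_map_eq_weightedCharFun hU, ← integral_complex_ofReal]
  simpa [weightedCharFun] using hcU.integral_fun_comp_mul_comp (f := ofReal)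
    (g := fun x : ℝ => cexp ((t * x : ℝ) * I)) hc hU (by fun_prop) (by fun_prop)

lemma hasDerivAt_charFun_map [IsFiniteMeasure P] (hU : Integrable U P) (t : ℝ) :
    HasDerivAt (charFun (P.map U)) (I * weightedCharFun P U U t) t := by
  have hcexp (ω : Ω) (s : ℝ) : HasDerivAt (fun s : ℝ => cexp ((s * U ω : ℝ) * I))
      (I * (U ω * cexp ((s * U ω : ℝ) * I))) s :=
    (HasDerivAt.scomp (h := (· * U ω)) s (hasDerivAt_cexp_mul_I (s * U ω))
      (hasDerivAt_mul_const (U ω))).congr_deriv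
      (by rw [real_smul]; ring)
  have hint (s : ℝ) : Integrable (fun ω => cexp ((s * U ω : ℝ) * I)) P := by
    simpa using integrable_mul_cexp_mul_I (integrable_const 1) hU.aemeasurable s
  have := hU.aemeasurable
  have hderiv := (hasDerivAt_integral_of_dominated_loc_of_deriv_le (bound := fun ω => |U ω|)
    (F' := fun s ω => I * (U ω * cexp ((s * U ω : ℝ) * I)))
    (Metric.ball_mem_nhds t one_pos) (Eventually.of_forall fun s => (hint s).1) (hint t)
    (by fun_prop) (Eventually.of_forall fun ω s _ => ?_) hU.abs
    (Eventually.of_forall fun ω s _ => hcexp ω s)).2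
  · rw [integral_const_mul] at hderiv
    refine hderiv.congr_of_eventuallyEq (Eventually.of_forall fun s => ?_)
    simp [charFun_map_eq_weightedCharFun this, weightedCharFun]
  · simp only [norm_mul, norm_I, one_mul, norm_exp_ofReal_mul_I, norm_real, Real.norm_eq_abs,
      mul_one, le_refl]

lemma norm_weightedCharFun_sub_le (hc : Integrable c P) (hU : AEMeasurable U P)
    (hV : AEMeasurable V P) (hcUV : Integrable (fun ω => |c ω| * |U ω - V ω|) P) (t : ℝ) :
    ‖weightedCharFun P c U t - weightedCharFun P c V t‖ ≤ |t| * ∫ ω, |c ω| * |U ω - V ω| ∂P := by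
  unfold weightedCharFun
  rw [← integral_sub (integrable_mul_cexp_mul_I hc hU t) (integrable_mul_cexp_mul_I hc hV t),
    ← integral_const_mul]
  refine norm_integral_le_of_norm_le (hcUV.const_mul _) (Eventually.of_forall fun ω => ?_)
  have hfactor : c ω * cexp ((t * U ω : ℝ) * I) - c ω * cexp ((t * V ω : ℝ) * I)
      = c ω * cexp ((t * V ω : ℝ) * I) * (cexp ((t * (U ω - V ω) : ℝ) * I) - 1) := by
    rw [mul_sub, mul_assoc, ← Complex.exp_add]
    push_cast
    ring_nf
  rw [hfactor, norm_mul, norm_mul, norm_exp_ofReal_mul_I, norm_real, Real.norm_eq_abs, mul_one]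
  calc |c ω| * ‖cexp ((t * (U ω - V ω) : ℝ) * I) - 1‖
      ≤ |c ω| * |t * (U ω - V ω)| := by gcongr; exact norm_cexp_mul_I_sub_one_le _
    _ = |t| * (|c ω| * |U ω - V ω|) := by rw [abs_mul]; ring

lemma norm_weightedCharFun_sub_sub_le (hc : Integrable c P) (hU : AEMeasurable U P)
    (hV : AEMeasurable V P) (hcUV : Integrable (fun ω => c ω * (U ω - V ω)) P)
    (hcUV₂ : Integrable (fun ω => |c ω| * (U ω - V ω) ^ 2) P) (t : ℝ) :
    ‖weightedCharFun P c U t - weightedCharFun P c V t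
        - t * I * weightedCharFun P (fun ω => c ω * (U ω - V ω)) U t‖
      ≤ t ^ 2 * ∫ ω, |c ω| * (U ω - V ω) ^ 2 ∂P := by
  unfold weightedCharFun
  rw [← integral_sub (integrable_mul_cexp_mul_I hc hU t) (integrable_mul_cexp_mul_I hc hV t),
    ← integral_const_mul, ← integral_const_mul, ← integral_sub
      (by exact (integrable_mul_cexp_mul_I hc hU t).sub (integrable_mul_cexp_mul_I hc hV t))
      ((integrable_mul_cexp_mul_I hcUV hU t).const_mul _)]
  refine norm_integral_le_of_norm_le (hcUV₂.const_mul _) (Eventually.of_forall fun ω => ?_)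
  have hfactor : c ω * cexp ((t * U ω : ℝ) * I) - c ω * cexp ((t * V ω : ℝ) * I)
        - t * I * ((c ω * (U ω - V ω) : ℝ) * cexp ((t * U ω : ℝ) * I))
      = -(c ω * cexp ((t * U ω : ℝ) * I) * (cexp ((-(t * (U ω - V ω)) : ℝ) * I) - 1
          - (-(t * (U ω - V ω)) : ℝ) * I)) := by
    have hexp : cexp ((t * V ω : ℝ) * I)
        = cexp ((t * U ω : ℝ) * I) * cexp ((-(t * (U ω - V ω)) : ℝ) * I) := by
      rw [← Complex.exp_add]
      push_cast
      ring_nf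
    rw [hexp]
    push_cast
    ring
  rw [hfactor, norm_neg, norm_mul, norm_mul, norm_exp_ofReal_mul_I, norm_real, Real.norm_eq_abs,
    mul_one]
  calc |c ω| * ‖cexp ((-(t * (U ω - V ω)) : ℝ) * I) - 1 - (-(t * (U ω - V ω)) : ℝ) * I‖
      ≤ |c ω| * (-(t * (U ω - V ω))) ^ 2 := by gcongr; exact norm_cexp_mul_I_sub_one_sub_le _
    _ = t ^ 2 * (|c ω| * (U ω - V ω) ^ 2) := by ring

end CharacteristicFunctions

section LocalDependence

open Complex

lemma sum_sub_sum_sdiff {ι M : Type*} [DecidableEq ι] [AddCommGroup M] {s t : Finset ι}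
    (h : t ⊆ s) (f : ι → M) : ∑ j ∈ s, f j - ∑ j ∈ s \ t, f j = ∑ j ∈ t, f j := by
  rw [← Finset.sum_sdiff h, add_sub_cancel_left]

variable {Ω : Type*} [MeasurableSpace Ω] {P : Measure Ω} [IsProbabilityMeasure P]

lemma charFun_map_zero {U : Ω → ℝ} (hU : AEMeasurable U P) : charFun (P.map U) 0 = 1 := by
  simp [charFun_map_eq_weightedCharFun hU, weightedCharFun]

lemma norm_charFun_map_sub_le {U V : Ω → ℝ} (hU : Integrable U P) (hV : Integrable V P) (t : ℝ) :
    ‖charFun (P.map U) t - charFun (P.map V) t‖ ≤ |t| * ∫ ω, |U ω - V ω| ∂P := by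
  rw [charFun_map_eq_weightedCharFun hU.aemeasurable,
    charFun_map_eq_weightedCharFun hV.aemeasurable]
  simpa using norm_weightedCharFun_sub_le (integrable_const 1) hU.aemeasurable hV.aemeasurable
    (by simpa using (hU.sub hV).abs) t

/-- `V` should be thought of as the part of `U` which is independent of `c`, and `a` as the value
which the rest of `U` is likely to take when it is weighted by `c`. -/
lemma norm_weightedCharFun_sub_mul_charFun_le {c U V : Ω → ℝ} {a : ℝ} (hc : Integrable c P)
    (hU : Integrable U P) (hV : Integrable V P)
    (hcUV : Integrable (fun ω => |c ω| * |U ω - (V ω + a)|) P) (hind : IndepFun c V P) (t : ℝ) :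
    ‖weightedCharFun P c U t
        - cexp ((t * a : ℝ) * I) * (∫ ω, c ω ∂P : ℝ) * charFun (P.map U) t‖
      ≤ |t| * (∫ ω, |c ω| * |U ω - (V ω + a)| ∂P
        + (∫ ω, |c ω| ∂P) * ∫ ω, |U ω - V ω| ∂P) := by
  have hreplace := norm_weightedCharFun_sub_le hc hU.aemeasurable
    (V := fun ω => V ω + a) (hV.aemeasurable.add_const a) hcUV t
  rw [weightedCharFun_add_const, weightedCharFun_of_indepFun hind hc.aemeasurable hV.aemeasurable,
    ← mul_assoc] at hreplace
  have hrestore := norm_charFun_map_sub_le hU hV t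
  rw [norm_sub_rev] at hrestore
  have hc' : ‖((∫ ω, c ω ∂P : ℝ) : ℂ)‖ ≤ ∫ ω, |c ω| ∂P := by
    rw [norm_real]
    exact norm_integral_le_integral_norm _
  calc _ ≤ _ := norm_sub_le_norm_sub_add_norm_sub _
        (cexp ((t * a : ℝ) * I) * (∫ ω, c ω ∂P : ℝ) * charFun (P.map V) t) _
    _ ≤ |t| * (∫ ω, |c ω| * |U ω - (V ω + a)| ∂P)
        + (∫ ω, |c ω| ∂P) * (|t| * ∫ ω, |U ω - V ω| ∂P) := by
      rw [← mul_sub, norm_mul, norm_mul, norm_exp_ofReal_mul_I, one_mul]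
      gcongr
    _ = _ := by ring

variable {ι : Type*} [DecidableEq ι] {s : Finset ι} {N : ι → Finset ι}

section Poisson

lemma norm_charFun_map_sub_poisson_le_of_weightedCharFun {X : Ω → ℝ} (hX : Integrable X P) {μ : ℝ}
    (hμ : 0 ≤ μ) {t ε : ℝ} (hε : ∀ u ∈ Set.uIcc 0 t,
      ‖weightedCharFun P X X u - μ * cexp (u * I) * charFun (P.map X) u‖ ≤ ε) :
    ‖charFun (P.map X) t - cexp (μ * (cexp (t * I) - 1))‖ ≤ ε * Real.exp (2 * μ) * |t| := by
  have hg (u : ℝ) : HasDerivAt (fun u : ℝ => (μ : ℂ) * (cexp (u * I) - 1))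
      (μ * (I * cexp (u * I))) u := ((hasDerivAt_cexp_mul_I u).sub_const 1).const_mul _
  refine norm_sub_cexp_le_of_hasDerivAt (hasDerivAt_charFun_map hX) hg
    (charFun_map_zero hX.aemeasurable) (by simp) (fun u hu => ?_) fun u _ => ?_
  · have hfactor : I * weightedCharFun P X X u - μ * (I * cexp (u * I)) * charFun (P.map X) u
        = I * (weightedCharFun P X X u - μ * cexp (u * I) * charFun (P.map X) u) := by ring
    rw [hfactor, norm_mul, norm_I, one_mul]
    exact hε u hu
  · rw [← mul_sub, norm_exp, re_ofReal_mul, sub_sub_sub_cancel_right, sub_re,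
      exp_ofReal_mul_I_re, exp_ofReal_mul_I_re, Real.exp_le_exp]
    nlinarith [Real.cos_le_one t, Real.neg_one_le_cos u]

variable {J : ι → Ω → ℝ}

lemma abs_le_one_of_eq_zero_or_eq_one {x : ℝ} (hx : x = 0 ∨ x = 1) : |x| ≤ 1 := by
  rcases hx with rfl | rfl <;> simp

lemma integrable_of_eq_zero_or_eq_one {Y : Ω → ℝ} (hY : AEMeasurable Y P)
    (hY01 : ∀ ω, Y ω = 0 ∨ Y ω = 1) : Integrable Y P :=
  .of_bound hY.aestronglyMeasurable 1
    (Eventually.of_forall fun ω => abs_le_one_of_eq_zero_or_eq_one (hY01 ω))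

lemma norm_weightedCharFun_sub_poisson_le (hN : ∀ i ∈ s, N i ⊆ s) (hself : ∀ i ∈ s, i ∈ N i)
    (hJm : ∀ i, AEMeasurable (J i) P) (hJ : ∀ i ω, J i ω = 0 ∨ J i ω = 1)
    (hind : ∀ i ∈ s, IndepFun (J i) (fun ω => ∑ j ∈ s \ N i, J j ω) P) {i : ι} (hi : i ∈ s)
    (t : ℝ) :
    ‖weightedCharFun P (J i) (fun ω => ∑ j ∈ s, J j ω) t
        - cexp (t * I) * (∫ ω, J i ω ∂P : ℝ) * charFun (P.map fun ω => ∑ j ∈ s, J j ω) t‖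
      ≤ |t| * (∑ j ∈ (N i).erase i, ∫ ω, J i ω * J j ω ∂P
          + ∑ j ∈ N i, (∫ ω, J i ω ∂P) * ∫ ω, J j ω ∂P) := by
  have hJ0 (j : ι) (ω : Ω) : 0 ≤ J j ω := by rcases hJ j ω with h | h <;> simp [h]
  have hJi (j : ι) : Integrable (J j) P := integrable_of_eq_zero_or_eq_one (hJm j) (hJ j)
  have hJJ (j : ι) : Integrable (fun ω => J i ω * J j ω) P := (hJi j).bdd_mul (hJi i).1
    (Eventually.of_forall fun ω => abs_le_one_of_eq_zero_or_eq_one (hJ i ω))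
  have hsum (ω : Ω) : ∑ j ∈ s, J j ω - ∑ j ∈ s \ N i, J j ω = ∑ j ∈ N i, J j ω :=
    sum_sub_sum_sdiff (hN i hi) _
  have hsum_erase (ω : Ω) : |J i ω| * |∑ j ∈ s, J j ω - (∑ j ∈ s \ N i, J j ω + 1)|
      = ∑ j ∈ (N i).erase i, J i ω * J j ω := by
    rcases hJ i ω with h | h
    · simp [h]
    · have hsub : ∑ j ∈ s, J j ω - (∑ j ∈ s \ N i, J j ω + 1) = ∑ j ∈ (N i).erase i, J j ω := by
        linarith [hsum ω, Finset.add_sum_erase (N i) (fun j => J j ω) (hself i hi)]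
      simp only [hsub, h, abs_one, one_mul, abs_of_nonneg (Finset.sum_nonneg fun j _ => hJ0 j ω)]
  have h := norm_weightedCharFun_sub_mul_charFun_le (a := 1) (hJi i)
    (integrable_finsetSum s fun j _ => hJi j) (integrable_finsetSum (s \ N i) fun j _ => hJi j)
    (by simpa only [hsum_erase] using integrable_finsetSum _ fun j _ => hJJ j) (hind i hi) t
  simp only [hsum, hsum_erase] at h
  simpa only [abs_of_nonneg (hJ0 i _), mul_one,
    abs_of_nonneg (Finset.sum_nonneg fun j _ => hJ0 j _), Finset.mul_sum,
    integral_finsetSum _ fun j _ => hJi j, integral_finsetSum _ fun j _ => hJJ j] using h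

theorem norm_charFun_map_sum_sub_poisson_le (hN : ∀ i ∈ s, N i ⊆ s) (hself : ∀ i ∈ s, i ∈ N i)
    (hJm : ∀ i, AEMeasurable (J i) P) (hJ : ∀ i ω, J i ω = 0 ∨ J i ω = 1)
    (hind : ∀ i ∈ s, IndepFun (J i) (fun ω => ∑ j ∈ s \ N i, J j ω) P) (t : ℝ) :
    ‖charFun (P.map fun ω => ∑ i ∈ s, J i ω) t
        - cexp ((∑ i ∈ s, ∫ ω, J i ω ∂P : ℝ) * (cexp (t * I) - 1))‖
      ≤ t ^ 2 * Real.exp (2 * ∑ i ∈ s, ∫ ω, J i ω ∂P)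
        * ∑ i ∈ s, (∑ j ∈ (N i).erase i, ∫ ω, J i ω * J j ω ∂P
          + ∑ j ∈ N i, (∫ ω, J i ω ∂P) * ∫ ω, J j ω ∂P) := by
  have hJ0 (j : ι) (ω : Ω) : 0 ≤ J j ω := by rcases hJ j ω with h | h <;> simp [h]
  have hJi (j : ι) : Integrable (J j) P := integrable_of_eq_zero_or_eq_one (hJm j) (hJ j)
  have hX : Integrable (fun ω => ∑ j ∈ s, J j ω) P := integrable_finsetSum _ fun j _ => hJi j
  set δ : ι → ℝ := fun i => ∑ j ∈ (N i).erase i, ∫ ω, J i ω * J j ω ∂P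
    + ∑ j ∈ N i, (∫ ω, J i ω ∂P) * ∫ ω, J j ω ∂P
  have hδ0 (i : ι) : 0 ≤ δ i := add_nonneg
    (Finset.sum_nonneg fun j _ => integral_nonneg fun ω => mul_nonneg (hJ0 i ω) (hJ0 j ω))
    (Finset.sum_nonneg fun j _ => mul_nonneg (integral_nonneg (hJ0 i)) (integral_nonneg (hJ0 j)))
  refine (norm_charFun_map_sub_poisson_le_of_weightedCharFun hX
    (Finset.sum_nonneg fun i _ => integral_nonneg (hJ0 i)) (ε := |t| * ∑ i ∈ s, δ i)
    fun u hu => ?_).trans_eq (by rw [← sq_abs t]; ring)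
  rw [weightedCharFun_sum (fun i _ => hJi i) hX.aemeasurable, ofReal_sum, Finset.sum_mul,
    Finset.sum_mul, ← Finset.sum_sub_distrib, Finset.mul_sum]
  refine norm_sum_le_of_le _ fun i hi => ?_
  rw [mul_comm (Complex.ofReal _)]
  refine (norm_weightedCharFun_sub_poisson_le hN hself hJm hJ hind hi u).trans ?_
  exact mul_le_mul_of_nonneg_right (by simpa using Set.abs_sub_left_of_mem_uIcc hu) (hδ0 i)

end Poisson

section Gaussian

lemma norm_charFun_map_sub_gaussian_le_of_weightedCharFun {W : Ω → ℝ} (hW : Integrable W P)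
    {t ε : ℝ} (hε : ∀ u ∈ Set.uIcc 0 t,
      ‖weightedCharFun P W W u - u * I * charFun (P.map W) u‖ ≤ ε) :
    ‖charFun (P.map W) t - cexp (-(t ^ 2 / 2 : ℝ))‖ ≤ ε * |t| := by
  have hg (u : ℝ) : HasDerivAt (fun u : ℝ => (-(u ^ 2 / 2 : ℝ) : ℂ)) (-(u : ℂ)) u :=
    (((hasDerivAt_id u).pow 2).div_const 2).ofReal_comp.neg.congr_deriv (by simp)
  refine (norm_sub_cexp_le_of_hasDerivAt (L := 1) (hasDerivAt_charFun_map hW) hg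
    (charFun_map_zero hW.aemeasurable) (by simp) (fun u hu => ?_) fun u hu => ?_).trans_eq
    (by rw [mul_one])
  · have hfactor : I * weightedCharFun P W W u - -(u : ℂ) * charFun (P.map W) u
        = I * (weightedCharFun P W W u - u * I * charFun (P.map W) u) := by
      linear_combination (u : ℂ) * charFun (P.map W) u * I_mul_I
    rw [hfactor, norm_mul, norm_I, one_mul]
    exact hε u hu
  · have hu' : u ^ 2 ≤ t ^ 2 := sq_le_sq.2 (by simpa using Set.abs_sub_left_of_mem_uIcc hu)
    rw [← ofReal_neg, ← ofReal_neg, ← ofReal_sub, norm_exp, ofReal_re, Real.exp_le_one_iff]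
    linarith

variable {ξ : ι → Ω → ℝ}

omit [IsProbabilityMeasure P] in
lemma integrable_mul_mul_of_memLp_three {f g h : Ω → ℝ} (hf : MemLp f 3 P) (hg : MemLp g 3 P)
    (hh : MemLp h 3 P) : Integrable (fun ω => f ω * g ω * h ω) P := by
  have hfgh : MemLp (fun ω => ∏ i : Fin 3, ![f, g, h] i ω) (∑ _i : Fin 3, (3 : ENNReal)⁻¹)⁻¹ P :=
    MemLp.prod' fun i _ => by fin_cases i <;> assumption
  have hexp : (∑ _i : Fin 3, (3 : ENNReal)⁻¹)⁻¹ = 1 := by simp [ENNReal.mul_inv_cancel]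
  rw [hexp, memLp_one_iff_integrable] at hfgh
  simpa [Fin.prod_univ_three] using hfgh

omit [IsProbabilityMeasure P] [DecidableEq ι] in
lemma integral_mul_mul_abs_sum_le (hξ : ∀ i, MemLp (ξ i) 3 P) (i j : ι) (T : Finset ι) :
    ∫ ω, |ξ i ω| * |ξ j ω| * |∑ k ∈ T, ξ k ω| ∂P
      ≤ ∑ k ∈ T, ∫ ω, |ξ i ω| * |ξ j ω| * |ξ k ω| ∂P := by
  have habs (k : ι) : Integrable (fun ω => |ξ i ω| * |ξ j ω| * |ξ k ω|) P :=
    integrable_mul_mul_of_memLp_three (hξ i).abs (hξ j).abs (hξ k).abs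
  rw [← integral_finsetSum _ fun k _ => habs k]
  refine integral_mono (integrable_mul_mul_of_memLp_three (hξ i).abs (hξ j).abs
    (memLp_finsetSum _ fun k _ => hξ k).abs) (integrable_finsetSum _ fun k _ => habs k) fun ω => ?_
  simp only [← Finset.mul_sum]
  gcongr
  exact Finset.abs_sum_le_sum_abs _ _

omit [IsProbabilityMeasure P] [DecidableEq ι] in
lemma integral_mul_sum_sq_le (hξ : ∀ i, MemLp (ξ i) 3 P) (i : ι) (T : Finset ι) :
    ∫ ω, |ξ i ω| * (∑ j ∈ T, ξ j ω) ^ 2 ∂P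
      ≤ ∑ j ∈ T, ∑ k ∈ T, ∫ ω, |ξ i ω| * |ξ j ω| * |ξ k ω| ∂P := by
  have hS : MemLp (fun ω => ∑ k ∈ T, ξ k ω) 3 P := memLp_finsetSum _ fun k _ => hξ k
  have hint (j : ι) : Integrable (fun ω => |ξ i ω| * |ξ j ω| * |∑ k ∈ T, ξ k ω|) P :=
    integrable_mul_mul_of_memLp_three (hξ i).abs (hξ j).abs hS.abs
  calc ∫ ω, |ξ i ω| * (∑ j ∈ T, ξ j ω) ^ 2 ∂P
      ≤ ∫ ω, ∑ j ∈ T, |ξ i ω| * |ξ j ω| * |∑ k ∈ T, ξ k ω| ∂P := by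
        refine integral_mono ?_ (integrable_finsetSum _ fun j _ => hint j) fun ω => ?_
        · simpa only [sq, mul_assoc, Pi.abs_apply] using
            integrable_mul_mul_of_memLp_three (hξ i).abs hS hS
        · simp only [← Finset.sum_mul, ← Finset.mul_sum]
          rw [← sq_abs, sq, ← mul_assoc]
          gcongr
          exact Finset.abs_sum_le_sum_abs _ _
    _ ≤ _ := by
        rw [integral_finsetSum _ fun j _ => hint j]
        exact Finset.sum_le_sum fun j _ => integral_mul_mul_abs_sum_le hξ i j T

lemma norm_weightedCharFun_sub_sum_le (hN : ∀ i ∈ s, N i ⊆ s) (hξ : ∀ i, MemLp (ξ i) 3 P)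
    (hξ0 : ∀ i ∈ s, ∫ ω, ξ i ω ∂P = 0)
    (hind : ∀ i ∈ s, IndepFun (ξ i) (fun ω => ∑ j ∈ s \ N i, ξ j ω) P) {i : ι} (hi : i ∈ s)
    (t : ℝ) :
    ‖weightedCharFun P (ξ i) (fun ω => ∑ j ∈ s, ξ j ω) t - t * I *
        ∑ j ∈ N i, weightedCharFun P (fun ω => ξ i ω * ξ j ω) (fun ω => ∑ j ∈ s, ξ j ω) t‖
      ≤ t ^ 2 * ∑ j ∈ N i, ∑ k ∈ N i, ∫ ω, |ξ i ω| * |ξ j ω| * |ξ k ω| ∂P := by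
  have hξi (j : ι) : Integrable (ξ j) P := (hξ j).integrable (by norm_num)
  have hξξ (j : ι) : Integrable (fun ω => ξ i ω * ξ j ω) P := by
    simpa using integrable_mul_mul_of_memLp_three (hξ i) (hξ j) (memLp_const 1)
  have hS (T : Finset ι) : MemLp (fun ω => ∑ j ∈ T, ξ j ω) 3 P := memLp_finsetSum _ fun j _ => hξ j
  have hsum (ω : Ω) : ∑ j ∈ s, ξ j ω - ∑ j ∈ s \ N i, ξ j ω = ∑ j ∈ N i, ξ j ω :=
    sum_sub_sum_sdiff (hN i hi) _
  have h := norm_weightedCharFun_sub_sub_le (hξi i) (hS s).aemeasurable (hS (s \ N i)).aemeasurable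
    (by simpa only [hsum, Finset.mul_sum] using integrable_finsetSum _ fun j _ => hξξ j)
    (by simpa only [hsum, sq, mul_assoc, Pi.abs_apply] using
      integrable_mul_mul_of_memLp_three (hξ i).abs (hS (N i)) (hS (N i))) t
  simp only [hsum, Finset.mul_sum (N i)] at h
  rw [weightedCharFun_of_indepFun (hind i hi) (hξi i).aemeasurable (hS _).aemeasurable, hξ0 i hi,
    ofReal_zero, zero_mul, sub_zero,
    weightedCharFun_sum (fun j _ => hξξ j) (hS s).aemeasurable] at h
  exact h.trans (mul_le_mul_of_nonneg_left (integral_mul_sum_sq_le hξ i (N i)) (sq_nonneg t))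

lemma norm_weightedCharFun_mul_sub_le {T : Finset ι} (hT : T ⊆ s)
    (hξ : ∀ i, MemLp (ξ i) 3 P) {i j : ι}
    (hind : IndepFun (fun ω => ξ i ω * ξ j ω) (fun ω => ∑ k ∈ s \ T, ξ k ω) P) (t : ℝ) :
    ‖weightedCharFun P (fun ω => ξ i ω * ξ j ω) (fun ω => ∑ k ∈ s, ξ k ω) t
        - (∫ ω, ξ i ω * ξ j ω ∂P : ℝ) * charFun (P.map fun ω => ∑ k ∈ s, ξ k ω) t‖
      ≤ |t| * ∑ k ∈ T, (∫ ω, |ξ i ω| * |ξ j ω| * |ξ k ω| ∂P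
          + (∫ ω, |ξ i ω| * |ξ j ω| ∂P) * ∫ ω, |ξ k ω| ∂P) := by
  have hξi (j : ι) : Integrable (ξ j) P := (hξ j).integrable (by norm_num)
  have hξξ : Integrable (fun ω => ξ i ω * ξ j ω) P := by
    simpa using integrable_mul_mul_of_memLp_three (hξ i) (hξ j) (memLp_const 1)
  have hsum (ω : Ω) : ∑ k ∈ s, ξ k ω - ∑ k ∈ s \ T, ξ k ω = ∑ k ∈ T, ξ k ω :=
    sum_sub_sum_sdiff hT _
  have habs : Integrable (fun ω => |ξ i ω| * |ξ j ω| * |∑ k ∈ T, ξ k ω|) P :=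
    integrable_mul_mul_of_memLp_three (hξ i).abs (hξ j).abs (memLp_finsetSum T fun k _ => hξ k).abs
  have h := norm_weightedCharFun_sub_mul_charFun_le (a := 0) hξξ
    (integrable_finsetSum s fun k _ => hξi k) (integrable_finsetSum (s \ T) fun k _ => hξi k)
    (by simpa only [add_zero, hsum, abs_mul] using habs)
    (by simpa only [add_zero] using hind) t
  simp only [add_zero, hsum, mul_zero, ofReal_zero, zero_mul, Complex.exp_zero, one_mul,
    abs_mul] at h
  refine h.trans (mul_le_mul_of_nonneg_left ?_ (abs_nonneg t))
  rw [Finset.sum_add_distrib, ← Finset.mul_sum, ← integral_finsetSum _ fun k _ => (hξi k).abs]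
  exact add_le_add (integral_mul_mul_abs_sum_le hξ i j T) <| mul_le_mul_of_nonneg_left
    (integral_mono (integrable_finsetSum T fun k _ => hξi k).abs
      (integrable_finsetSum _ fun k _ => (hξi k).abs) fun ω => Finset.abs_sum_le_sum_abs _ _)
    (integral_nonneg fun ω => by positivity)

lemma norm_weightedCharFun_sub_covariance_le (hN : ∀ i ∈ s, N i ⊆ s) (hξ : ∀ i, MemLp (ξ i) 3 P)
    (hξ0 : ∀ i ∈ s, ∫ ω, ξ i ω ∂P = 0)
    (hind : ∀ i ∈ s, IndepFun (ξ i) (fun ω => ∑ j ∈ s \ N i, ξ j ω) P)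
    (hind₂ : ∀ i ∈ s, ∀ j ∈ N i,
      IndepFun (fun ω => ξ i ω * ξ j ω) (fun ω => ∑ k ∈ s \ (N i ∪ N j), ξ k ω) P)
    {i : ι} (hi : i ∈ s) (t : ℝ) :
    ‖weightedCharFun P (ξ i) (fun ω => ∑ j ∈ s, ξ j ω) t - t * I *
        ∑ j ∈ N i, (∫ ω, ξ i ω * ξ j ω ∂P : ℝ) * charFun (P.map fun ω => ∑ j ∈ s, ξ j ω) t‖
      ≤ 2 * t ^ 2 * ∑ j ∈ N i, ∑ k ∈ N i ∪ N j,
        (∫ ω, |ξ i ω| * |ξ j ω| * |ξ k ω| ∂P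
          + (∫ ω, |ξ i ω| * |ξ j ω| ∂P) * ∫ ω, |ξ k ω| ∂P) := by
  set W : Ω → ℝ := fun ω => ∑ i ∈ s, ξ i ω
  set ε : ι → ι → ℝ := fun j k => ∫ ω, |ξ i ω| * |ξ j ω| * |ξ k ω| ∂P
    + (∫ ω, |ξ i ω| * |ξ j ω| ∂P) * ∫ ω, |ξ k ω| ∂P
  have hdecoupled (j k : ι) : 0 ≤ (∫ ω, |ξ i ω| * |ξ j ω| ∂P) * ∫ ω, |ξ k ω| ∂P :=
    mul_nonneg (integral_nonneg fun ω => by positivity) (integral_nonneg fun ω => by positivity)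
  have hε0 (j k : ι) : 0 ≤ ε j k :=
    add_nonneg (integral_nonneg fun ω => by positivity) (hdecoupled j k)
  have hfirst : ‖weightedCharFun P (ξ i) W t
        - t * I * ∑ j ∈ N i, weightedCharFun P (fun ω => ξ i ω * ξ j ω) W t‖
      ≤ t ^ 2 * ∑ j ∈ N i, ∑ k ∈ N i ∪ N j, ε j k := by
    refine (norm_weightedCharFun_sub_sum_le hN hξ hξ0 hind hi t).trans ?_
    gcongr with j _
    exact (Finset.sum_le_sum fun k _ => le_add_of_nonneg_right (hdecoupled j k)).trans
      (Finset.sum_le_sum_of_subset_of_nonneg Finset.subset_union_left fun k _ _ => hε0 j k)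
  have hsecond : ‖∑ j ∈ N i, (weightedCharFun P (fun ω => ξ i ω * ξ j ω) W t
        - (∫ ω, ξ i ω * ξ j ω ∂P : ℝ) * charFun (P.map W) t)‖
      ≤ |t| * ∑ j ∈ N i, ∑ k ∈ N i ∪ N j, ε j k := by
    rw [Finset.mul_sum]
    exact norm_sum_le_of_le _ fun j hj => norm_weightedCharFun_mul_sub_le
      (Finset.union_subset (hN i hi) (hN j (hN i hi hj))) hξ (hind₂ i hi j hj) t
  rw [← sub_add_sub_cancel _ (t * I * ∑ j ∈ N i, weightedCharFun P (fun ω => ξ i ω * ξ j ω) W t),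
    ← mul_sub, ← Finset.sum_sub_distrib, two_mul, add_mul]
  refine norm_add_le_of_le hfirst ?_
  rw [norm_mul, norm_mul, norm_I, mul_one, norm_real, Real.norm_eq_abs, ← sq_abs, sq, mul_assoc]
  exact mul_le_mul_of_nonneg_left hsecond (abs_nonneg t)

theorem norm_charFun_map_sum_sub_gaussian_le (hN : ∀ i ∈ s, N i ⊆ s) (hξ : ∀ i, MemLp (ξ i) 3 P)
    (hξ0 : ∀ i ∈ s, ∫ ω, ξ i ω ∂P = 0)
    (hind : ∀ i ∈ s, IndepFun (ξ i) (fun ω => ∑ j ∈ s \ N i, ξ j ω) P)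
    (hind₂ : ∀ i ∈ s, ∀ j ∈ N i,
      IndepFun (fun ω => ξ i ω * ξ j ω) (fun ω => ∑ k ∈ s \ (N i ∪ N j), ξ k ω) P)
    (hvar : ∑ i ∈ s, ∑ j ∈ N i, ∫ ω, ξ i ω * ξ j ω ∂P = 1) (t : ℝ) :
    ‖charFun (P.map fun ω => ∑ i ∈ s, ξ i ω) t - cexp (-(t ^ 2 / 2 : ℝ))‖
      ≤ 2 * |t| ^ 3 * ∑ i ∈ s, ∑ j ∈ N i, ∑ k ∈ N i ∪ N j,
        (∫ ω, |ξ i ω| * |ξ j ω| * |ξ k ω| ∂P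
          + (∫ ω, |ξ i ω| * |ξ j ω| ∂P) * ∫ ω, |ξ k ω| ∂P) := by
  have hξi (j : ι) : Integrable (ξ j) P := (hξ j).integrable (by norm_num)
  have hWi : Integrable (fun ω => ∑ i ∈ s, ξ i ω) P := integrable_finsetSum _ fun j _ => hξi j
  set ε : ι → ι → ι → ℝ := fun i j k => ∫ ω, |ξ i ω| * |ξ j ω| * |ξ k ω| ∂P
    + (∫ ω, |ξ i ω| * |ξ j ω| ∂P) * ∫ ω, |ξ k ω| ∂P
  have hε0 (i j k : ι) : 0 ≤ ε i j k := add_nonneg (integral_nonneg fun ω => by positivity)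
    (mul_nonneg (integral_nonneg fun ω => by positivity) (integral_nonneg fun ω => by positivity))
  refine (norm_charFun_map_sub_gaussian_le_of_weightedCharFun hWi
    (ε := 2 * t ^ 2 * ∑ i ∈ s, ∑ j ∈ N i, ∑ k ∈ N i ∪ N j, ε i j k)
    fun u hu => ?_).trans_eq (by rw [← sq_abs t]; ring)
  have hu' : u ^ 2 ≤ t ^ 2 := sq_le_sq.2 (by simpa using Set.abs_sub_left_of_mem_uIcc hu)
  have hone : charFun (P.map fun ω => ∑ i ∈ s, ξ i ω) u = ∑ i ∈ s, ∑ j ∈ N i,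
      (∫ ω, ξ i ω * ξ j ω ∂P : ℝ) * charFun (P.map fun ω => ∑ i ∈ s, ξ i ω) u := by
    simp only [← Finset.sum_mul, ← ofReal_sum, hvar, ofReal_one, one_mul]
  rw [hone, weightedCharFun_sum (fun i _ => hξi i) hWi.aemeasurable, Finset.mul_sum,
    ← Finset.sum_sub_distrib, Finset.mul_sum]
  refine norm_sum_le_of_le _ fun i hi =>
    (norm_weightedCharFun_sub_covariance_le hN hξ hξ0 hind hind₂ hi u).trans ?_
  exact mul_le_mul_of_nonneg_right (by gcongr)
    (Finset.sum_nonneg fun j _ => Finset.sum_nonneg fun k _ => hε0 i j k)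

end Gaussian

end LocalDependence

section ConvergenceInDistribution

lemma tendstoInDistribution_of_tendsto_charFun {Ω' : Type*} {Ω : ℕ → Type*}
    [∀ n, MeasurableSpace (Ω n)] {P : ∀ n, Measure (Ω n)} [∀ n, IsProbabilityMeasure (P n)]
    [MeasurableSpace Ω'] {P' : Measure Ω'} [IsProbabilityMeasure P'] {X : ∀ n, Ω n → ℝ}
    {Z : Ω' → ℝ} (hX : ∀ n, AEMeasurable (X n) (P n)) (hZ : AEMeasurable Z P')
    (h : ∀ t, Tendsto (fun n => charFun ((P n).map (X n)) t) atTop (𝓝 (charFun (P'.map Z) t))) :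
    TendstoInDistribution X atTop Z P P' where
  forall_aemeasurable := hX
  aemeasurable_limit := hZ
  tendsto := ProbabilityMeasure.tendsto_of_tendsto_charFun h

lemma tendstoInDistribution_of_isClosedEmbedding {ι Ω' E G : Type*} {Ω : ι → Type*}
    [∀ i, MeasurableSpace (Ω i)] {P : ∀ i, Measure (Ω i)} [∀ i, IsProbabilityMeasure (P i)]
    [MeasurableSpace Ω'] {P' : Measure Ω'} [IsProbabilityMeasure P']
    [TopologicalSpace E] [MeasurableSpace E] [BorelSpace E]
    [TopologicalSpace G] [NormalSpace G] [MeasurableSpace G] [OpensMeasurableSpace G]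
    {f : E → G} (hf : IsClosedEmbedding f) {X : ∀ i, Ω i → E} {Z : Ω' → E} {l : Filter ι}
    (hX : ∀ i, AEMeasurable (X i) (P i)) (hZ : AEMeasurable Z P')
    (h : TendstoInDistribution (fun i ω => f (X i ω)) l (fun ω => f (Z ω)) P P') :
    TendstoInDistribution X l Z P P' where
  forall_aemeasurable := hX
  aemeasurable_limit := hZ
  tendsto := by
    refine ProbabilityMeasure.tendsto_iff_forall_integral_tendsto.2 fun φ => ?_
    obtain ⟨g, -, hgφ⟩ :=
      BoundedContinuousFunction.exists_extension_norm_eq_of_isClosedEmbedding φ hf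
    have hlim := ProbabilityMeasure.tendsto_iff_forall_integral_tendsto.1 h.tendsto g
    simp only [ProbabilityMeasure.coe_mk, ← hgφ] at hlim ⊢
    rw [integral_map h.aemeasurable_limit g.continuous.aestronglyMeasurable] at hlim
    rw [integral_map hZ (g.continuous.comp hf.continuous).aestronglyMeasurable]
    refine hlim.congr fun i => ?_
    rw [integral_map (h.forall_aemeasurable i) g.continuous.aestronglyMeasurable,
      integral_map (hX i) (g.continuous.comp hf.continuous).aestronglyMeasurable]
    rfl

end ConvergenceInDistribution

section RandomSet

variable {α : Type*} {p : unitInterval}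

lemma iIndepFun_mem_setBernoulli (u : Set α) :
    iIndepFun (fun (i : α) (S : Set α) => i ∈ S) (setBernoulli u p) := by
  have hmem : Measurable fun (S : Set α) i => i ∈ S := measurable_pi_lambda _ measurable_set_mem
  have hset : Measurable fun q : α → Prop => {i | q i} := MeasurableEquiv.setOfPred.measurable
  let ν (i : α) : Measure Prop := unitInterval.toNNReal p • Measure.dirac (i ∈ u)
    + unitInterval.toNNReal (unitInterval.symm p) • Measure.dirac False
  have hmap : (setBernoulli u p).map (fun S i => i ∈ S) = Measure.infinitePi ν := by
    rw [setBernoulli_eq_map, Measure.map_map hmem hset]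
    exact Measure.map_id
  rw [iIndepFun_iff_map_fun_eq_infinitePi_map measurable_set_mem, hmap]
  congr 1
  funext i
  rw [← Measure.infinitePi_map_eval ν i, ← hmap, Measure.map_map (measurable_pi_apply i) hmem]
  rfl

lemma comp_trace_eq {β : Type*} {A : Finset α} {f : Set α → β} (hf : ∀ S, f (S ∩ A) = f S) :
    (fun y : A → Prop => f {i | ∃ h : i ∈ A, y ⟨i, h⟩}) ∘ (fun S (i : A) => (i : α) ∈ S) = f := by
  funext S
  rw [← hf S, Function.comp_apply]
  congr 1
  ext i
  simp [and_comm]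

lemma indepFun_setBernoulli {β γ : Type*} [MeasurableSpace β] [MeasurableSpace γ] (u : Set α)
    {A B : Finset α} (hAB : Disjoint A B) {f : Set α → β} {g : Set α → γ}
    (hf : ∀ S, f (S ∩ A) = f S) (hg : ∀ S, g (S ∩ B) = g S) :
    IndepFun f g (setBernoulli u p) := by
  have hmem := (iIndepFun_mem_setBernoulli (p := p) u).indepFun_finset A B hAB measurable_set_mem
  have h := hmem.comp
    (measurable_of_countable fun y : A → Prop => f {i | ∃ h : i ∈ A, y ⟨i, h⟩})
    (measurable_of_countable fun y : B → Prop => g {i | ∃ h : i ∈ B, y ⟨i, h⟩})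
  rwa [comp_trace_eq hf, comp_trace_eq hg] at h

/-- The indicator of the event that the random set contains `a`. -/
noncomputable def containsInd (a : Finset α) : Set α → ℝ :=
  {S : Set α | (a : Set α) ⊆ S}.indicator 1

lemma containsInd_of_subset {a : Finset α} {S : Set α} (h : (a : Set α) ⊆ S) :
    containsInd a S = 1 := Set.indicator_of_mem (s := {S : Set α | (a : Set α) ⊆ S}) h 1

lemma containsInd_eq_zero_or_eq_one (a : Finset α) (S : Set α) :
    containsInd a S = 0 ∨ containsInd a S = 1 :=
  Set.indicator_eq_zero_or_self _ _ _

lemma containsInd_nonneg (a : Finset α) (S : Set α) : 0 ≤ containsInd a S :=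
  Set.indicator_nonneg (fun _ _ => zero_le_one) S

@[simp]
lemma containsInd_empty (S : Set α) : containsInd ∅ S = 1 := containsInd_of_subset (by simp)

lemma containsInd_union [DecidableEq α] (a b : Finset α) (S : Set α) :
    containsInd (a ∪ b) S = containsInd a S * containsInd b S := by
  simp only [containsInd, Finset.coe_union, Set.union_subset_iff]
  exact congrFun Set.inter_indicator_one S

lemma containsInd_inter {a A : Finset α} (h : a ⊆ A) (S : Set α) :
    containsInd a (S ∩ A) = containsInd a S := by
  have hA : (a : Set α) ⊆ A := Finset.coe_subset.2 h
  exact Set.indicator_eq_indicator (by simp [hA]) rfl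

lemma measurableSet_superset (a : Finset α) : MeasurableSet {S : Set α | (a : Set α) ⊆ S} := by
  have h : {S : Set α | (a : Set α) ⊆ S} = ⋂ i ∈ a, {S : Set α | i ∈ S} := by
    ext S; simp [Set.subset_def]
  rw [h]
  exact Finset.measurableSet_biInter _ fun i _ => measurableSet_mem i

@[fun_prop]
lemma measurable_containsInd (a : Finset α) : Measurable (containsInd a) :=
  measurable_one.indicator (measurableSet_superset a)

lemma integral_containsInd {u : Set α} {a : Finset α} (ha : (a : Set α) ⊆ u) :
    ∫ S, containsInd a S ∂(setBernoulli u p) = (p : ℝ) ^ a.card := by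
  rw [containsInd, integral_indicator_one (measurableSet_superset a), measureReal_def,
    setBernoulli_apply']
  have hpi : (fun q : α → Prop => {i | q i}) ⁻¹' {S : Set α | (a : Set α) ⊆ S}
      = Set.pi a (fun _ => {True}) := by
    ext q; simp [Set.subset_def, Set.mem_pi]
  have hcoord : ∀ i ∈ a, (unitInterval.toNNReal p • Measure.dirac (i ∈ u)
      + unitInterval.toNNReal (unitInterval.symm p) • Measure.dirac False) {True}
      = unitInterval.toNNReal p := fun i hi => by simp [ha hi]
  rw [hpi, Measure.infinitePi_pi _ fun _ _ => measurableSet_singleton _,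
    Finset.prod_congr rfl hcoord, Finset.prod_const]
  simp

end RandomSet

section CenteredIndicators

variable {α : Type*} {u : Set α} {p : unitInterval} {a : Finset α}

/-- The containment indicator of `a` minus its mean, when `a` lies in the ground set of the
`p`-random set. -/
noncomputable def centeredInd (p : ℝ) (a : Finset α) (S : Set α) : ℝ :=
  containsInd a S - p ^ a.card

lemma memLp_containsInd (r : ENNReal) (a : Finset α) :
    MemLp (containsInd a) r (setBernoulli u p) :=
  .of_bound (measurable_containsInd a).aestronglyMeasurable 1 <| .of_forall fun S => by
    rcases containsInd_eq_zero_or_eq_one a S with h | h <;> simp [h]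

lemma memLp_centeredInd (r : ENNReal) (q : ℝ) (a : Finset α) :
    MemLp (centeredInd q a) r (setBernoulli u p) :=
  (memLp_containsInd r a).sub (memLp_const _)

lemma integrable_containsInd (a : Finset α) : Integrable (containsInd a) (setBernoulli u p) :=
  memLp_one_iff_integrable.1 (memLp_containsInd 1 a)

lemma integral_centeredInd (ha : (a : Set α) ⊆ u) :
    ∫ S, centeredInd p a S ∂(setBernoulli u p) = 0 := by
  simp only [centeredInd]
  rw [integral_sub (integrable_containsInd a) (integrable_const _), integral_containsInd ha,
    integral_const, probReal_univ, one_smul, sub_self]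

lemma abs_centeredInd_le (p : unitInterval) (a : Finset α) (S : Set α) :
    |centeredInd p a S| ≤ containsInd a S + (p : ℝ) ^ a.card := by
  have h := abs_sub (containsInd a S) ((p : ℝ) ^ a.card)
  rwa [abs_of_nonneg (containsInd_nonneg a S), abs_of_nonneg (pow_nonneg p.2.1 _)] at h

lemma centeredInd_inter {q : ℝ} {A : Finset α} (h : a ⊆ A) (S : Set α) :
    centeredInd q a (S ∩ A) = centeredInd q a S := by
  rw [centeredInd, centeredInd, containsInd_inter h]

end CenteredIndicators

section SetFamilies

variable {α : Type*} [DecidableEq α]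

/-- The members of the family `F` that meet `a`: the dependency neighbourhood of `a`. -/
def meeting (F : Finset (Finset α)) (a : Finset α) : Finset (Finset α) :=
  {b ∈ F | ¬ Disjoint a b}

/-- The weight, with `q ^ |a ∪ b ∪ c|` for each, of the triples in `F` whose last two members meet
the first. It controls the error in the normal approximation. -/
noncomputable def tripleSum (F : Finset (Finset α)) (q : ℝ) : ℝ :=
  ∑ a ∈ F, ∑ b ∈ meeting F a, ∑ c ∈ meeting F a, q ^ (a ∪ b ∪ c).card

variable {u : Set α} {p : unitInterval} {F : Finset (Finset α)} {a b : Finset α}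

lemma mem_meeting : b ∈ meeting F a ↔ b ∈ F ∧ ¬ Disjoint a b := Finset.mem_filter

lemma meeting_subset (F : Finset (Finset α)) (a : Finset α) : meeting F a ⊆ F :=
  Finset.filter_subset _ _

lemma disjoint_of_mem_sdiff_meeting (h : b ∈ F \ meeting F a) : Disjoint a b := by
  rw [Finset.mem_sdiff, mem_meeting] at h
  tauto

section Moments

lemma covariance_containsInd (ha : (a : Set α) ⊆ u) (hb : (b : Set α) ⊆ u) :
    cov[containsInd a, containsInd b; setBernoulli u p]
      = (p : ℝ) ^ (a ∪ b).card - (p : ℝ) ^ (a.card + b.card) := by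
  have hab : ((a ∪ b : Finset α) : Set α) ⊆ u := by simp [ha, hb]
  rw [covariance_eq_sub (memLp_containsInd 2 a) (memLp_containsInd 2 b), integral_containsInd ha,
    integral_containsInd hb, pow_add, ← integral_containsInd hab]
  simp only [containsInd_union, Pi.mul_apply]

lemma integral_centeredInd_mul (ha : (a : Set α) ⊆ u) (hb : (b : Set α) ⊆ u) :
    ∫ S, centeredInd p a S * centeredInd p b S ∂(setBernoulli u p)
      = (p : ℝ) ^ (a ∪ b).card - (p : ℝ) ^ (a.card + b.card) := by
  rw [← covariance_containsInd ha hb, covariance, integral_containsInd ha, integral_containsInd hb]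
  rfl

lemma containsInd_mul_prod_cons (q : ℝ) (e c : Finset α) (L : List (Finset α)) (S : Set α) :
    containsInd e S * ((c :: L).map fun c => containsInd c S + q ^ c.card).prod
      = containsInd (e ∪ c) S * (L.map fun c => containsInd c S + q ^ c.card).prod
        + q ^ c.card * (containsInd e S * (L.map fun c => containsInd c S + q ^ c.card).prod) := by
  rw [List.map_cons, List.prod_cons, containsInd_union]
  ring

omit [DecidableEq α] in
lemma integrable_containsInd_mul_prod (q : ℝ) (L : List (Finset α)) (e : Finset α) :
    Integrable (fun S => containsInd e S * (L.map fun c => containsInd c S + q ^ c.card).prod)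
      (setBernoulli u p) := by
  classical
  induction L generalizing e with
  | nil => simpa using integrable_containsInd e
  | cons c L ih =>
    simp only [containsInd_mul_prod_cons]
    exact (ih (e ∪ c)).add ((ih e).const_mul _)

omit [DecidableEq α] in
lemma integral_containsInd_mul_prod_le {L : List (Finset α)} (hL : ∀ c ∈ L, (c : Set α) ⊆ u)
    {d e : Finset α} (he : (e : Set α) ⊆ u) (hd : ∀ x ∈ d, x ∈ e ∨ ∃ c ∈ L, x ∈ c) :
    ∫ S, containsInd e S * (L.map fun c => containsInd c S + (p : ℝ) ^ c.card).prod
        ∂(setBernoulli u p) ≤ 2 ^ L.length * (p : ℝ) ^ d.card := by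
  classical
  induction L generalizing d e with
  | nil =>
    have hde : d ⊆ e := fun x hx => by simpa using hd x hx
    simpa [integral_containsInd he] using
      pow_le_pow_of_le_one p.2.1 p.2.2 (Finset.card_le_card hde)
  | cons c L ih =>
    rw [List.forall_mem_cons] at hL
    have hwith := ih hL.2 (d := d) (e := e ∪ c) (by simp [he, hL.1]) fun x hx => by
      simpa [or_assoc] using hd x hx
    have hwithout := ih hL.2 (d := d \ c) he fun x hx => by
      have := hd x (Finset.sdiff_subset hx)
      simp_all
    have hcard : d.card ≤ c.card + (d \ c).card := by
      simpa [add_comm] using Finset.card_le_card_sdiff_add_card (s := d) (t := c)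
    simp only [containsInd_mul_prod_cons]
    rw [integral_add (integrable_containsInd_mul_prod _ L _)
      ((integrable_containsInd_mul_prod _ L _).const_mul _), integral_const_mul]
    calc _ ≤ 2 ^ L.length * (p : ℝ) ^ d.card
          + (p : ℝ) ^ c.card * (2 ^ L.length * (p : ℝ) ^ (d \ c).card) :=
        add_le_add hwith (mul_le_mul_of_nonneg_left hwithout (pow_nonneg p.2.1 _))
      _ = 2 ^ L.length * (p : ℝ) ^ d.card
          + 2 ^ L.length * (p : ℝ) ^ (c.card + (d \ c).card) := by ring
      _ ≤ 2 ^ L.length * (p : ℝ) ^ d.card + 2 ^ L.length * (p : ℝ) ^ d.card := by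
        gcongr _ + _ * ?_
        exact pow_le_pow_of_le_one p.2.1 p.2.2 hcard
      _ = _ := by rw [List.length_cons]; ring

omit [DecidableEq α] in
lemma integral_prod_abs_centeredInd_le {L : List (Finset α)} (hL : ∀ c ∈ L, (c : Set α) ⊆ u)
    {d : Finset α} (hd : ∀ x ∈ d, ∃ c ∈ L, x ∈ c) :
    ∫ S, (L.map fun c => |centeredInd p c S|).prod ∂(setBernoulli u p)
      ≤ 2 ^ L.length * (p : ℝ) ^ d.card := by
  classical
  refine (integral_mono_of_nonneg (.of_forall fun S => List.prod_nonneg (by simp))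
    (integrable_containsInd_mul_prod p L ∅) <| .of_forall fun S => ?_).trans
    (integral_containsInd_mul_prod_le hL (by simp) (by simpa using hd))
  simpa using List.prod_map_le_prod_map₀ _ _ (fun c _ => abs_nonneg (centeredInd p c S))
    fun c _ => abs_centeredInd_le p c S

lemma integral_abs_centeredInd_triple_le {c : Finset α} (ha : (a : Set α) ⊆ u)
    (hb : (b : Set α) ⊆ u) (hc : (c : Set α) ⊆ u) :
    ∫ S, |centeredInd p a S| * |centeredInd p b S| * |centeredInd p c S| ∂(setBernoulli u p)
      + (∫ S, |centeredInd p a S| * |centeredInd p b S| ∂(setBernoulli u p))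
        * ∫ S, |centeredInd p c S| ∂(setBernoulli u p)
      ≤ 16 * (p : ℝ) ^ (a ∪ b ∪ c).card := by
  have habc : ∫ S, |centeredInd p a S| * |centeredInd p b S| * |centeredInd p c S|
      ∂(setBernoulli u p) ≤ 8 * (p : ℝ) ^ (a ∪ b ∪ c).card := by
    simpa [mul_assoc, ha, hb, hc, show (2 : ℝ) ^ 3 = 8 by norm_num] using
      integral_prod_abs_centeredInd_le (p := p) (u := u) (L := [a, b, c]) (d := a ∪ b ∪ c)
  have hab : ∫ S, |centeredInd p a S| * |centeredInd p b S| ∂(setBernoulli u p)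
      ≤ 4 * (p : ℝ) ^ (a ∪ b).card := by
    simpa [ha, hb, show (2 : ℝ) ^ 2 = 4 by norm_num] using
      integral_prod_abs_centeredInd_le (p := p) (u := u) (L := [a, b]) (d := a ∪ b)
  have hc1 : ∫ S, |centeredInd p c S| ∂(setBernoulli u p) ≤ 2 * (p : ℝ) ^ c.card := by
    simpa [hc] using integral_prod_abs_centeredInd_le (p := p) (u := u) (L := [c]) (d := c)
  have hpow : (p : ℝ) ^ ((a ∪ b).card + c.card) ≤ (p : ℝ) ^ (a ∪ b ∪ c).card :=
    pow_le_pow_of_le_one p.2.1 p.2.2 (Finset.card_union_le _ _)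
  calc _ ≤ 8 * (p : ℝ) ^ (a ∪ b ∪ c).card
        + 4 * (p : ℝ) ^ (a ∪ b).card * (2 * (p : ℝ) ^ c.card) :=
      add_le_add habc (mul_le_mul hab hc1 (integral_nonneg fun S => abs_nonneg _)
        (mul_nonneg (by norm_num) (pow_nonneg p.2.1 _)))
    _ = 8 * (p : ℝ) ^ (a ∪ b ∪ c).card + 8 * (p : ℝ) ^ ((a ∪ b).card + c.card) := by ring
    _ ≤ _ := by linarith

end Moments

section Variance

lemma variance_sum_containsInd (hF : ∀ a ∈ F, (a : Set α) ⊆ u) :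
    Var[fun S => ∑ a ∈ F, containsInd a S; setBernoulli u p]
      = ∑ a ∈ F, ∑ b ∈ F, ((p : ℝ) ^ (a ∪ b).card - (p : ℝ) ^ (a.card + b.card)) := by
  rw [variance_fun_sum' fun a _ => memLp_containsInd 2 a]
  exact Finset.sum_congr rfl fun a ha => Finset.sum_congr rfl fun b hb =>
    covariance_containsInd (hF a ha) (hF b hb)

lemma variance_eq_sum_meeting (hF : ∀ a ∈ F, (a : Set α) ⊆ u) :
    Var[fun S => ∑ a ∈ F, containsInd a S; setBernoulli u p]
      = ∑ a ∈ F, ∑ b ∈ meeting F a,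
        ((p : ℝ) ^ (a ∪ b).card - (p : ℝ) ^ (a.card + b.card)) := by
  rw [variance_sum_containsInd hF]
  refine Finset.sum_congr rfl fun a _ => (Finset.sum_subset (meeting_subset F a) ?_).symm
  intro b hb hb'
  rw [Finset.card_union_of_disjoint (disjoint_of_mem_sdiff_meeting (Finset.mem_sdiff.2 ⟨hb, hb'⟩)),
    sub_self]

omit [DecidableEq α] in
lemma sum_pow_mul_le_variance (hF : ∀ a ∈ F, (a : Set α) ⊆ u) :
    ∑ a ∈ F, (p : ℝ) ^ a.card * (1 - (p : ℝ) ^ a.card)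
      ≤ Var[fun S => ∑ a ∈ F, containsInd a S; setBernoulli u p] := by
  classical
  rw [variance_sum_containsInd hF]
  refine Finset.sum_le_sum fun a ha => ?_
  refine le_trans (Eq.le ?_) (Finset.single_le_sum (fun b _ => sub_nonneg.2
    (pow_le_pow_of_le_one p.2.1 p.2.2 (Finset.card_union_le a b))) ha)
  rw [Finset.union_self]
  ring

lemma pow_mul_one_sub_mul_le_pow_sub_pow {q : ℝ} (hq₀ : 0 ≤ q) (hq₁ : q ≤ 1) {m r s : ℕ}
    (h : m + r = s) : q ^ (s - 1) * (1 - q) * r ≤ q ^ m - q ^ s := by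
  subst h
  rcases r with _ | r
  · simp
  have hgeom : (r + 1) * q ^ r ≤ ∑ i ∈ Finset.range (r + 1), q ^ i := by
    simpa using Finset.card_nsmul_le_sum (Finset.range (r + 1)) (fun i => q ^ i) (q ^ r)
      fun i hi => pow_le_pow_of_le_one hq₀ hq₁ (Finset.mem_range_succ_iff.1 hi)
  calc q ^ (m + (r + 1) - 1) * (1 - q) * (r + 1 : ℕ)
        = q ^ m * (1 - q) * ((r + 1) * q ^ r) := by
        rw [← add_assoc, Nat.add_sub_cancel, pow_add]; push_cast; ring
    _ ≤ q ^ m * (1 - q) * ∑ i ∈ Finset.range (r + 1), q ^ i := by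
        have := sub_nonneg.2 hq₁
        gcongr
    _ = q ^ m - q ^ (m + (r + 1)) := by rw [mul_assoc, mul_neg_geom_sum]; ring

lemma sum_card_eq_sum_card_filter_mem {ι : Type*} {s : Finset ι} {f : ι → Finset α} {v : Finset α}
    (h : ∀ i ∈ s, f i ⊆ v) : ∑ i ∈ s, (f i).card = ∑ x ∈ v, {i ∈ s | x ∈ f i}.card := by
  rw [Finset.sum_congr rfl fun i hi => congrArg Finset.card (Finset.inter_eq_right.2 (h i hi)).symm]
  simpa only [Finset.bipartiteAbove, Finset.bipartiteBelow, Finset.filter_mem_eq_inter] using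
    Finset.sum_card_bipartiteAbove_eq_sum_card_bipartiteBelow (s := s) (t := v) fun i x => x ∈ f i

lemma sq_sum_card_le_card_mul_sum_card_inter {v : Finset α} (hF : ∀ a ∈ F, a ⊆ v) :
    (∑ a ∈ F, a.card) ^ 2 ≤ v.card * ∑ a ∈ F, ∑ b ∈ F, (a ∩ b).card := by
  have hinter : ∑ a ∈ F, ∑ b ∈ F, (a ∩ b).card = ∑ x ∈ v, {a ∈ F | x ∈ a}.card ^ 2 := by
    rw [← Finset.sum_product' F F fun a b => (a ∩ b).card, sum_card_eq_sum_card_filter_mem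
      fun z hz => Finset.inter_subset_left.trans (hF z.1 (Finset.mem_product.1 hz).1)]
    refine Finset.sum_congr rfl fun x _ => ?_
    rw [sq, ← Finset.card_product, ← Finset.filter_product]
    simp only [Finset.mem_inter]
  rw [hinter, sum_card_eq_sum_card_filter_mem hF]
  exact sq_sum_le_card_mul_sum_sq

omit [DecidableEq α] in
lemma pow_mul_sq_card_mul_le_variance {v : Finset α} {ℓ : ℕ} (hF : F ⊆ v.powersetCard ℓ) :
    (p : ℝ) ^ (2 * ℓ - 1) * (1 - p) * (F.card * ℓ : ℝ) ^ 2
      ≤ v.card * Var[fun S => ∑ a ∈ F, containsInd a S; setBernoulli v p] := by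
  classical
  have hv (a) (ha : a ∈ F) : a ⊆ v := (Finset.mem_powersetCard.1 (hF ha)).1
  have hcard (a) (ha : a ∈ F) : a.card = ℓ := (Finset.mem_powersetCard.1 (hF ha)).2
  have hsq : (F.card * ℓ : ℝ) ^ 2 ≤ v.card * ∑ a ∈ F, ∑ b ∈ F, ((a ∩ b).card : ℝ) := by
    have := sq_sum_card_le_card_mul_sum_card_inter hv
    rw [Finset.sum_congr rfl hcard, Finset.sum_const, smul_eq_mul] at this
    exact_mod_cast this
  have hp1 : 0 ≤ 1 - (p : ℝ) := sub_nonneg.2 p.2.2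
  have hp0 : 0 ≤ (p : ℝ) := p.2.1
  calc _ ≤ (p : ℝ) ^ (2 * ℓ - 1) * (1 - p) * (v.card * ∑ a ∈ F, ∑ b ∈ F, ((a ∩ b).card : ℝ)) := by
        gcongr
    _ = v.card * ∑ a ∈ F, ∑ b ∈ F, (p : ℝ) ^ (2 * ℓ - 1) * (1 - p) * ((a ∩ b).card : ℝ) := by
        simp only [← Finset.mul_sum]; ring
    _ ≤ _ := by
        rw [variance_sum_containsInd fun a ha => Finset.coe_subset.2 (hv a ha)]
        gcongr with a ha b hb
        rw [hcard a ha, hcard b hb, ← two_mul]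
        refine pow_mul_one_sub_mul_le_pow_sub_pow hp0 p.2.2 ?_
        rw [Finset.card_union_add_card_inter, hcard a ha, hcard b hb, two_mul]

end Variance

section Approximation

omit [DecidableEq α] in
lemma indepFun_sum_of_disjoint (u : Set α) {A : Finset α} {G : Finset (Finset α)}
    (hG : ∀ b ∈ G, Disjoint A b) {f : Set α → ℝ} (hf : ∀ S, f (S ∩ A) = f S)
    {g : Finset α → Set α → ℝ} (hg : ∀ b B, b ⊆ B → ∀ S, g b (S ∩ (B : Finset α)) = g b S) :
    IndepFun f (fun S => ∑ b ∈ G, g b S) (setBernoulli u p) := by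
  classical
  exact indepFun_setBernoulli u ((Finset.disjoint_biUnion_right _ _ id).2 hG) hf fun S =>
    Finset.sum_congr rfl fun b hb => hg b _ (Finset.subset_biUnion_of_mem id hb) S

open Complex in
lemma norm_charFun_map_sum_containsInd_sub_poisson_le (hF : ∀ a ∈ F, (a : Set α) ⊆ u)
    (hne : ∀ a ∈ F, a.Nonempty) (t : ℝ) :
    ‖charFun ((setBernoulli u p).map fun S => ∑ a ∈ F, containsInd a S) t
        - cexp ((∑ a ∈ F, (p : ℝ) ^ a.card : ℝ) * (cexp (t * I) - 1))‖
      ≤ t ^ 2 * Real.exp (2 * ∑ a ∈ F, (p : ℝ) ^ a.card)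
        * ∑ a ∈ F, (∑ b ∈ (meeting F a).erase a, (p : ℝ) ^ (a ∪ b).card
          + ∑ b ∈ meeting F a, (p : ℝ) ^ a.card * (p : ℝ) ^ b.card) := by
  have h := norm_charFun_map_sum_sub_poisson_le (P := setBernoulli u p) (s := F) (N := meeting F)
    (J := containsInd) (fun a _ => meeting_subset F a)
    (fun a ha => mem_meeting.2 ⟨ha, by simpa using (hne a ha).ne_empty⟩)
    (fun a => (measurable_containsInd a).aemeasurable) containsInd_eq_zero_or_eq_one
    (fun a _ => indepFun_sum_of_disjoint u (fun _ => disjoint_of_mem_sdiff_meeting)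
      (containsInd_inter subset_rfl) fun _ _ => containsInd_inter) t
  have hmean : ∀ a ∈ F, ∫ S, containsInd a S ∂(setBernoulli u p) = (p : ℝ) ^ a.card :=
    fun a ha => integral_containsInd (hF a ha)
  rw [Finset.sum_congr rfl hmean] at h
  refine h.trans_eq (congrArg _ (Finset.sum_congr rfl fun a ha => congrArg₂ _ ?_ ?_))
  · refine Finset.sum_congr rfl fun b hb => ?_
    have hb' := meeting_subset F a (Finset.mem_of_mem_erase hb)
    simp only [← containsInd_union]
    exact integral_containsInd (by simp [hF a ha, hF b hb'])
  · exact Finset.sum_congr rfl fun b hb => by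
      rw [hmean a ha, hmean b (meeting_subset F a hb)]

lemma tripleSum_union_le {q : ℝ} (hq : 0 ≤ q) :
    ∑ a ∈ F, ∑ b ∈ meeting F a, ∑ c ∈ meeting F a ∪ meeting F b, q ^ (a ∪ b ∪ c).card
      ≤ 2 * tripleSum F q := by
  have hswap : ∑ a ∈ F, ∑ b ∈ meeting F a, ∑ c ∈ meeting F b, q ^ (a ∪ b ∪ c).card
      = tripleSum F q := by
    rw [Finset.sum_comm' (t' := F) (s' := meeting F) (h := fun a b => by
      simp only [mem_meeting, disjoint_comm (a := a)]; tauto)]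
    simp only [tripleSum, Finset.union_comm]
  calc _ ≤ ∑ a ∈ F, ∑ b ∈ meeting F a, (∑ c ∈ meeting F a, q ^ (a ∪ b ∪ c).card
        + ∑ c ∈ meeting F b, q ^ (a ∪ b ∪ c).card) := by
        gcongr with a _ b _
        rw [← Finset.sum_union_inter]
        exact le_add_of_nonneg_right (Finset.sum_nonneg fun _ _ => pow_nonneg hq _)
    _ = _ := by
        simp only [Finset.sum_add_distrib]
        rw [hswap, two_mul, tripleSum]

open Complex in
lemma norm_charFun_map_sum_containsInd_sub_gaussian_le (hF : ∀ a ∈ F, (a : Set α) ⊆ u) {σ : ℝ}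
    (hσ : 0 < σ) (hvar : Var[fun S => ∑ a ∈ F, containsInd a S; setBernoulli u p] = σ ^ 2)
    (t : ℝ) :
    ‖charFun ((setBernoulli u p).map fun S => ∑ a ∈ F, centeredInd p a S / σ) t
        - cexp (-(t ^ 2 / 2 : ℝ))‖ ≤ 64 * |t| ^ 3 * tripleSum F p / σ ^ 3 := by
  have hinter {a A : Finset α} (h : a ⊆ A) (S : Set α) :
      centeredInd p a (S ∩ A) / σ = centeredInd p a S / σ := by rw [centeredInd_inter h]
  refine (norm_charFun_map_sum_sub_gaussian_le (P := setBernoulli u p) (s := F) (N := meeting F)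
    (ξ := fun a S => centeredInd p a S / σ) (fun a _ => meeting_subset F a)
    (fun a => by simpa only [div_eq_mul_inv] using (memLp_centeredInd 3 p a).mul_const σ⁻¹)
    (fun a ha => by rw [integral_div, integral_centeredInd (hF a ha), zero_div])
    (fun a _ => indepFun_sum_of_disjoint u (fun _ => disjoint_of_mem_sdiff_meeting)
      (hinter subset_rfl) fun _ _ => hinter)
    (fun a _ b _ => indepFun_sum_of_disjoint (A := a ∪ b) u (fun c hc => ?_) (fun S => ?_)
      fun _ _ => hinter) ?_ t).trans ?_
  · rw [Finset.sdiff_union_distrib, Finset.mem_inter] at hc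
    exact Finset.disjoint_union_left.2
      ⟨disjoint_of_mem_sdiff_meeting hc.1, disjoint_of_mem_sdiff_meeting hc.2⟩
  · rw [hinter Finset.subset_union_left, hinter Finset.subset_union_right]
  · simp only [div_mul_div_comm, integral_div, ← Finset.sum_div]
    rw [div_eq_one_iff_eq (by positivity), ← sq, ← hvar, variance_eq_sum_meeting hF]
    exact Finset.sum_congr rfl fun a ha => Finset.sum_congr rfl fun b hb =>
      integral_centeredInd_mul (hF a ha) (hF b (meeting_subset F a hb))
  · calc _ ≤ 2 * |t| ^ 3 * ∑ a ∈ F, ∑ b ∈ meeting F a, ∑ c ∈ meeting F a ∪ meeting F b,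
          16 * (p : ℝ) ^ (a ∪ b ∪ c).card / σ ^ 3 := by
          gcongr with a ha b hb c hc
          have hb' := meeting_subset F a hb
          have hc' := Finset.union_subset (meeting_subset F a) (meeting_subset F b) hc
          have := integral_abs_centeredInd_triple_le (p := p) (hF a ha) (hF b hb') (hF c hc')
          simp only [abs_div, abs_of_pos hσ, div_mul_div_comm, integral_div]
          rw [mul_assoc, ← add_div, ← pow_three]
          gcongr
      _ = 2 * |t| ^ 3 * (16 * (∑ a ∈ F, ∑ b ∈ meeting F a, ∑ c ∈ meeting F a ∪ meeting F b,
          (p : ℝ) ^ (a ∪ b ∪ c).card) / σ ^ 3) := by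
          simp only [← Finset.sum_div, ← Finset.mul_sum]
      _ ≤ 2 * |t| ^ 3 * (16 * (2 * tripleSum F p) / σ ^ 3) := by
          gcongr
          exact tripleSum_union_le p.2.1
      _ = _ := by ring

end Approximation

end SetFamilies

section SparseFamilies

variable {α : Type*} [DecidableEq α] {F : Finset (Finset α)} {A a b c : Finset α} {ℓ : ℕ}
  {M r K q t : ℝ}

/-- The members of `F` that share exactly one point with `A`. -/
def meetingOnce (F : Finset (Finset α)) (A : Finset α) : Finset (Finset α) :=
  {b ∈ F | (A ∩ b).card = 1}

/-- The members of `F` that share at least two points with `A`. -/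
def meetingTwice (F : Finset (Finset α)) (A : Finset α) : Finset (Finset α) :=
  {b ∈ F | 2 ≤ (A ∩ b).card}

/-- An `ℓ`-uniform family of sets in which every point has degree at most `M`, every pair of points
has codegree at most `ℓ ^ 2`, and, given a member `a`, the further members `c` that meet `a` at
least twice have bounded total weight, where `c` is weighted by `r ^ (|c \ a| - 1)`. -/
structure IsSparse (F : Finset (Finset α)) (ℓ : ℕ) (M r K : ℝ) : Prop where
  card_eq : ∀ a ∈ F, a.card = ℓ
  degree_le : ∀ x, (({a ∈ F | x ∈ a} : Finset (Finset α)).card : ℝ) ≤ M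
  codegree_le : ∀ x y, x ≠ y → ({a ∈ F | x ∈ a ∧ y ∈ a} : Finset (Finset α)).card ≤ ℓ ^ 2
  sum_le : ∀ a ∈ F, ∑ c ∈ (meetingTwice F a).erase a, r ^ ((c \ a).card - 1) ≤ K

lemma mem_meetingOnce : b ∈ meetingOnce F A ↔ b ∈ F ∧ (A ∩ b).card = 1 := Finset.mem_filter

lemma mem_meetingTwice : b ∈ meetingTwice F A ↔ b ∈ F ∧ 2 ≤ (A ∩ b).card := Finset.mem_filter

lemma not_disjoint_iff_card_inter_pos : ¬ Disjoint a b ↔ 0 < (a ∩ b).card := by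
  rw [Finset.not_disjoint_iff_nonempty_inter, Finset.card_pos]

lemma sum_meeting (F : Finset (Finset α)) (a : Finset α) (f : Finset α → ℝ) :
    ∑ b ∈ meeting F a, f b = ∑ b ∈ meetingTwice F a, f b + ∑ b ∈ meetingOnce F a, f b := by
  have hdisj : Disjoint (meetingTwice F a) (meetingOnce F a) :=
    Finset.disjoint_filter.2 fun _ _ h h' => by omega
  rw [← Finset.sum_union hdisj]
  congr 1
  ext b
  simp only [mem_meeting, Finset.mem_union, mem_meetingTwice, mem_meetingOnce,
    not_disjoint_iff_card_inter_pos, ← and_or_left]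
  exact and_congr_right fun _ => by omega

lemma card_union_sdiff (a b c : Finset α) :
    ((b ∪ c) \ a).card = (b \ a).card + (c \ (a ∪ b)).card := by
  rw [Finset.union_comm b, ← Finset.card_sdiff_add_card_inter ((c ∪ b) \ a) b, add_comm]
  congr 2 <;> grind

lemma sum_ite_mem_le {ι : Type*} [DecidableEq ι] {u v : Finset ι} {f : ι → ℝ}
    (hf : ∀ i ∈ v, 0 ≤ f i) : ∑ i ∈ u, (if i ∈ v then f i else 0) ≤ ∑ i ∈ v, f i := by
  rw [← Finset.sum_filter]
  exact Finset.sum_le_sum_of_subset_of_nonneg (fun i hi => (Finset.mem_filter.1 hi).2)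
    fun i hi _ => hf i hi

lemma card_meetingTwice_le (hcod : ∀ x y, x ≠ y →
    ({a ∈ F | x ∈ a ∧ y ∈ a} : Finset (Finset α)).card ≤ ℓ ^ 2) (A : Finset α) :
    (meetingTwice F A).card ≤ A.card ^ 2 * ℓ ^ 2 := by
  have hsub : meetingTwice F A ⊆ A.offDiag.biUnion fun x => {a ∈ F | x.1 ∈ a ∧ x.2 ∈ a} := by
    intro b hb
    obtain ⟨hb, hAb⟩ := mem_meetingTwice.1 hb
    obtain ⟨x, hx, y, hy, hxy⟩ := Finset.one_lt_card.1 hAb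
    rw [Finset.mem_inter] at hx hy
    exact Finset.mem_biUnion.2 ⟨(x, y), Finset.mem_offDiag.2 ⟨hx.1, hy.1, hxy⟩,
      Finset.mem_filter.2 ⟨hb, hx.2, hy.2⟩⟩
  calc (meetingTwice F A).card
      ≤ A.offDiag.card * ℓ ^ 2 := (Finset.card_le_card hsub).trans <|
        Finset.card_biUnion_le_card_mul _ _ _ fun x hx =>
          hcod _ _ (Finset.mem_offDiag.1 hx).2.2
    _ ≤ A.card ^ 2 * ℓ ^ 2 := by
        gcongr
        rw [Finset.offDiag_card, sq]
        exact Nat.sub_le _ _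

namespace IsSparse

lemma card_meeting_le (h : IsSparse F ℓ M r K) (A : Finset α) :
    ((meeting F A).card : ℝ) ≤ A.card * M := by
  have hsub : meeting F A ⊆ A.biUnion fun x => {a ∈ F | x ∈ a} := by
    intro b hb
    obtain ⟨hb, hAb⟩ := mem_meeting.1 hb
    obtain ⟨x, hx, hx'⟩ := Finset.not_disjoint_iff.1 hAb
    exact Finset.mem_biUnion.2 ⟨x, hx, Finset.mem_filter.2 ⟨hb, hx'⟩⟩
  calc ((meeting F A).card : ℝ)
      ≤ ∑ x ∈ A, (({a ∈ F | x ∈ a} : Finset (Finset α)).card : ℝ) := by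
        exact_mod_cast (Finset.card_le_card hsub).trans Finset.card_biUnion_le
    _ ≤ A.card * M := by
        rw [← nsmul_eq_mul]
        exact Finset.sum_le_card_nsmul _ _ _ fun x _ => h.degree_le x

lemma card_meetingOnce_le (h : IsSparse F ℓ M r K) (ha : a ∈ F) :
    ((meetingOnce F a).card : ℝ) ≤ ℓ * M := by
  rw [← h.card_eq a ha]
  refine le_trans ?_ (h.card_meeting_le a)
  gcongr
  intro b hb
  rw [mem_meetingOnce] at hb
  exact mem_meeting.2 ⟨hb.1, not_disjoint_iff_card_inter_pos.2 (by omega)⟩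

lemma card_meetingTwice_self_le (h : IsSparse F ℓ M r K) (ha : a ∈ F) :
    ((meetingTwice F a).card : ℝ) ≤ ℓ ^ 4 := by
  have hT := card_meetingTwice_le h.codegree_le a
  rw [h.card_eq a ha, ← pow_add] at hT
  exact_mod_cast hT

lemma card_meetingTwice_union_le (h : IsSparse F ℓ M r K) (ha : a ∈ F) (hc : c ∈ F) :
    ((meetingTwice F (a ∪ c)).card : ℝ) ≤ 4 * ℓ ^ 4 := by
  have hac : (a ∪ c).card ≤ 2 * ℓ := by
    linarith [Finset.card_union_le a c, h.card_eq a ha, h.card_eq c hc]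
  have hT : (meetingTwice F (a ∪ c)).card ≤ 4 * ℓ ^ 4 :=
    calc _ ≤ (a ∪ c).card ^ 2 * ℓ ^ 2 := card_meetingTwice_le h.codegree_le _
      _ ≤ (2 * ℓ) ^ 2 * ℓ ^ 2 := by gcongr
      _ = 4 * ℓ ^ 4 := by ring
  exact_mod_cast hT

lemma one_le_card_sdiff (h : IsSparse F ℓ M r K) (ha : a ∈ F) (hc : c ∈ F) (hne : c ≠ a) :
    1 ≤ (c \ a).card := by
  rw [Nat.one_le_iff_ne_zero, Finset.card_ne_zero, Finset.sdiff_nonempty]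
  intro hsub
  exact hne (Finset.eq_of_subset_of_card_le hsub (by rw [h.card_eq a ha, h.card_eq c hc]))

lemma card_inter_add_card_sdiff (h : IsSparse F ℓ M r K) (hb : b ∈ F) (A : Finset α) :
    (A ∩ b).card + (b \ A).card = ℓ := by
  rw [Finset.inter_comm, Finset.card_inter_add_card_sdiff, h.card_eq b hb]

lemma card_sdiff_of_mem_meetingOnce (h : IsSparse F ℓ M r K) (hb : b ∈ meetingOnce F a) :
    (b \ a).card = ℓ - 1 := by
  rw [mem_meetingOnce] at hb
  have := h.card_inter_add_card_sdiff hb.1 a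
  omega

lemma le_card_sdiff_of_notMem_meetingTwice (h : IsSparse F ℓ M r K) (hb : b ∈ F)
    (hA : b ∉ meetingTwice F A) : ℓ - 1 ≤ (b \ A).card := by
  have hcard : ¬ 2 ≤ (A ∩ b).card := fun h2 => hA (mem_meetingTwice.2 ⟨hb, h2⟩)
  have := h.card_inter_add_card_sdiff hb A
  omega

lemma mem_meetingTwice_self (h : IsSparse F ℓ M r K) (hℓ : 2 ≤ ℓ) (ha : a ∈ F) :
    a ∈ meetingTwice F a := by
  rw [mem_meetingTwice, Finset.inter_self, h.card_eq a ha]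
  exact ⟨ha, hℓ⟩

lemma mem_meeting_self (h : IsSparse F ℓ M r K) (hℓ : 2 ≤ ℓ) (ha : a ∈ F) : a ∈ meeting F a := by
  rw [mem_meeting, not_disjoint_iff_card_inter_pos, Finset.inter_self, h.card_eq a ha]
  exact ⟨ha, by omega⟩

lemma nonneg_of_mem (h : IsSparse F ℓ M r K) (hr : 0 ≤ r) (ha : a ∈ F) : 0 ≤ K :=
  (Finset.sum_nonneg fun _ _ => pow_nonneg hr _).trans (h.sum_le a ha)

lemma sum_pow_sub_one_le (h : IsSparse F ℓ M r K) (ha : a ∈ F) (ht0 : 0 ≤ t) (ht : t ≤ r) :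
    ∑ c ∈ (meetingTwice F a).erase a, t ^ ((c \ a).card - 1) ≤ K :=
  (Finset.sum_le_sum fun _ _ => pow_le_pow_left₀ ht0 ht _).trans (h.sum_le a ha)

lemma sum_erase_meetingTwice_pow_le (h : IsSparse F ℓ M r K) (ha : a ∈ F) (ht0 : 0 ≤ t)
    (ht : t ≤ r) : ∑ c ∈ (meetingTwice F a).erase a, t ^ (c \ a).card ≤ t * K := by
  refine le_trans (le_of_eq ?_) (mul_le_mul_of_nonneg_left (h.sum_pow_sub_one_le ha ht0 ht) ht0)
  rw [Finset.mul_sum]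
  refine Finset.sum_congr rfl fun c hc => ?_
  rw [Finset.mem_erase, mem_meetingTwice] at hc
  rw [← pow_succ', Nat.sub_add_cancel (h.one_le_card_sdiff ha hc.2.1 hc.1)]

lemma sum_meetingTwice_pow_sub_one_le (h : IsSparse F ℓ M r K) (hℓ : 2 ≤ ℓ) (ha : a ∈ F)
    (ht0 : 0 ≤ t) (ht : t ≤ r) : ∑ c ∈ meetingTwice F a, t ^ ((c \ a).card - 1) ≤ 1 + K := by
  rw [← Finset.add_sum_erase _ _ (h.mem_meetingTwice_self hℓ ha)]
  exact add_le_add (by simp) (h.sum_pow_sub_one_le ha ht0 ht)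

lemma sum_meetingTwice_pow_le (h : IsSparse F ℓ M r K) (hℓ : 2 ≤ ℓ) (ha : a ∈ F) (ht0 : 0 ≤ t)
    (ht : t ≤ r) (hr : r ≤ 1) : ∑ c ∈ meetingTwice F a, t ^ (c \ a).card ≤ 1 + K :=
  (Finset.sum_le_sum fun _ _ => pow_le_pow_of_le_one ht0 (ht.trans hr) (Nat.sub_le _ 1)).trans
    (h.sum_meetingTwice_pow_sub_one_le hℓ ha ht0 ht)

lemma sum_erase_meeting_pow_le (h : IsSparse F ℓ M r K) (hℓ : 2 ≤ ℓ) (ha : a ∈ F) (hq0 : 0 ≤ q)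
    (hq : q ≤ r) :
    ∑ b ∈ (meeting F a).erase a, q ^ (a ∪ b).card ≤ q ^ ℓ * (ℓ * M * q ^ (ℓ - 1) + q * K) := by
  have hunion (b) : q ^ (a ∪ b).card = q ^ ℓ * q ^ (b \ a).card := by
    rw [← pow_add, ← h.card_eq a ha, Finset.union_comm, ← Finset.card_sdiff_add_card, add_comm]
  have hsplit : ∑ b ∈ (meeting F a).erase a, q ^ (b \ a).card
      = ∑ b ∈ meetingOnce F a, q ^ (b \ a).card
        + ∑ b ∈ (meetingTwice F a).erase a, q ^ (b \ a).card := by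
    have hsum := sum_meeting F a fun b => q ^ (b \ a).card
    rw [← Finset.add_sum_erase _ _ (h.mem_meeting_self hℓ ha),
      ← Finset.add_sum_erase _ _ (h.mem_meetingTwice_self hℓ ha)] at hsum
    linarith
  simp only [hunion, ← Finset.mul_sum]
  rw [hsplit]
  gcongr
  · rw [Finset.sum_congr rfl fun b hb => by rw [h.card_sdiff_of_mem_meetingOnce hb],
      Finset.sum_const, nsmul_eq_mul]
    gcongr
    exact h.card_meetingOnce_le ha
  · exact h.sum_erase_meetingTwice_pow_le ha hq0 hq

lemma sum_twice_twice_le (h : IsSparse F ℓ M r K) (hℓ : 2 ≤ ℓ) (hq0 : 0 ≤ q) (hq : √q ≤ r)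
    (hr : r ≤ 1) (ha : a ∈ F) :
    ∑ b ∈ meetingTwice F a, ∑ c ∈ meetingTwice F a, q ^ ((b ∪ c) \ a).card ≤ (1 + K) ^ 2 := by
  have hterm (b c) : q ^ ((b ∪ c) \ a).card ≤ √q ^ (b \ a).card * √q ^ (c \ a).card := by
    have hb : (b \ a).card ≤ ((b ∪ c) \ a).card := by gcongr; exact Finset.subset_union_left
    have hc : (c \ a).card ≤ ((b ∪ c) \ a).card := by gcongr; exact Finset.subset_union_right
    nth_rewrite 1 [← Real.sq_sqrt hq0]
    rw [← pow_mul, ← pow_add]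
    exact pow_le_pow_of_le_one (Real.sqrt_nonneg q) (hq.trans hr) (by omega)
  calc _ ≤ ∑ b ∈ meetingTwice F a, ∑ c ∈ meetingTwice F a,
          √q ^ (b \ a).card * √q ^ (c \ a).card := by
        gcongr
        exact hterm _ _
    _ = (∑ c ∈ meetingTwice F a, √q ^ (c \ a).card) ^ 2 := by rw [sq, Finset.sum_mul_sum]
    _ ≤ (1 + K) ^ 2 := by
        gcongr
        exact h.sum_meetingTwice_pow_le hℓ ha (Real.sqrt_nonneg q) hq hr

lemma pow_card_union_sdiff_le (h : IsSparse F ℓ M r K) (hq0 : 0 ≤ q) (hq1 : q ≤ 1)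
    (hb : b ∈ meetingOnce F a) (c : Finset α) :
    q ^ ((b ∪ c) \ a).card ≤ q ^ (ℓ - 1) * q ^ (c \ a).card
      + if b ∈ meetingTwice F (a ∪ c) then q ^ (ℓ - 1) else 0 := by
  split_ifs with hb'
  · refine le_add_of_nonneg_of_le (by positivity) (pow_le_pow_of_le_one hq0 hq1 ?_)
    rw [card_union_sdiff, h.card_sdiff_of_mem_meetingOnce hb]
    exact Nat.le_add_right _ _
  · rw [add_zero, ← pow_add, Finset.union_comm b, card_union_sdiff, add_comm (ℓ - 1)]
    have := h.le_card_sdiff_of_notMem_meetingTwice (mem_meetingOnce.1 hb).1 hb'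
    exact pow_le_pow_of_le_one hq0 hq1 (by gcongr)

lemma sum_meetingOnce_pow_card_union_sdiff_le (h : IsSparse F ℓ M r K) (hq0 : 0 ≤ q)
    (hq1 : q ≤ 1) (ha : a ∈ F) (hc : c ∈ F) :
    ∑ b ∈ meetingOnce F a, q ^ ((b ∪ c) \ a).card
      ≤ ℓ * M * q ^ (ℓ - 1) * q ^ (c \ a).card + 4 * ℓ ^ 4 * q ^ (ℓ - 1) := by
  calc ∑ b ∈ meetingOnce F a, q ^ ((b ∪ c) \ a).card
      ≤ (meetingOnce F a).card * (q ^ (ℓ - 1) * q ^ (c \ a).card)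
        + ∑ b ∈ meetingOnce F a, if b ∈ meetingTwice F (a ∪ c) then q ^ (ℓ - 1) else 0 := by
        rw [← nsmul_eq_mul, ← Finset.sum_const, ← Finset.sum_add_distrib]
        exact Finset.sum_le_sum fun b hb => h.pow_card_union_sdiff_le hq0 hq1 hb c
    _ ≤ (meetingOnce F a).card * (q ^ (ℓ - 1) * q ^ (c \ a).card)
        + (meetingTwice F (a ∪ c)).card * q ^ (ℓ - 1) := by
        gcongr
        rw [← nsmul_eq_mul, ← Finset.sum_const]
        exact sum_ite_mem_le fun _ _ => pow_nonneg hq0 _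
    _ ≤ ℓ * M * (q ^ (ℓ - 1) * q ^ (c \ a).card) + 4 * ℓ ^ 4 * q ^ (ℓ - 1) := by
        gcongr
        · exact h.card_meetingOnce_le ha
        · exact h.card_meetingTwice_union_le ha hc
    _ = _ := by ring

lemma sum_twice_once_le (h : IsSparse F ℓ M r K) (hℓ : 2 ≤ ℓ) (hq0 : 0 ≤ q) (hq : q ≤ r)
    (hr : r ≤ 1) (ha : a ∈ F) :
    ∑ c ∈ meetingTwice F a, ∑ b ∈ meetingOnce F a, q ^ ((b ∪ c) \ a).card
      ≤ ℓ * M * q ^ (ℓ - 1) * (1 + K) + 4 * ℓ ^ 8 * q ^ (ℓ - 1) := by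
  have hD : 0 ≤ ℓ * M := (Nat.cast_nonneg _).trans (h.card_meetingOnce_le ha)
  calc _ ≤ ∑ c ∈ meetingTwice F a,
          (ℓ * M * q ^ (ℓ - 1) * q ^ (c \ a).card + 4 * ℓ ^ 4 * q ^ (ℓ - 1)) :=
        Finset.sum_le_sum fun c hc => h.sum_meetingOnce_pow_card_union_sdiff_le hq0 (hq.trans hr)
          ha (mem_meetingTwice.1 hc).1
    _ = ℓ * M * q ^ (ℓ - 1) * (∑ c ∈ meetingTwice F a, q ^ (c \ a).card)
        + (meetingTwice F a).card * (4 * ℓ ^ 4 * q ^ (ℓ - 1)) := by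
        rw [Finset.sum_add_distrib, ← Finset.mul_sum, Finset.sum_const, nsmul_eq_mul]
    _ ≤ ℓ * M * q ^ (ℓ - 1) * (1 + K) + ℓ ^ 4 * (4 * ℓ ^ 4 * q ^ (ℓ - 1)) := by
        gcongr
        · exact h.sum_meetingTwice_pow_le hℓ ha hq0 hq hr
        · exact h.card_meetingTwice_self_le ha
    _ = _ := by ring

lemma pow_card_sdiff_union_le (h : IsSparse F ℓ M r K) (hq0 : 0 ≤ q) (hq1 : q ≤ 1)
    (b : Finset α) (hc : c ∈ meetingOnce F a) :
    q ^ (c \ (a ∪ b)).card ≤ q ^ (ℓ - 1)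
      + (if c ∈ meetingTwice F (a ∪ b) then q ^ (ℓ - 2) else 0)
      + if c ∈ meetingTwice F b then q ^ ((c \ b).card - 1) else 0 := by
  obtain ⟨hcF, hac⟩ := mem_meetingOnce.1 hc
  have hsdiff : (c \ b).card - 1 ≤ (c \ (a ∪ b)).card := by
    have hsub : c \ b ⊆ c \ (a ∪ b) ∪ a ∩ c := by grind
    have := (Finset.card_le_card hsub).trans (Finset.card_union_le _ _)
    omega
  split_ifs with hab hb hb
  · exact le_add_of_nonneg_of_le (by positivity) (pow_le_pow_of_le_one hq0 hq1 hsdiff)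
  · have := h.le_card_sdiff_of_notMem_meetingTwice hcF hb
    rw [add_zero]
    exact le_add_of_nonneg_of_le (by positivity) (pow_le_pow_of_le_one hq0 hq1 (by omega))
  · exact le_add_of_nonneg_of_le (by positivity) (pow_le_pow_of_le_one hq0 hq1 hsdiff)
  · rw [add_zero, add_zero]
    exact pow_le_pow_of_le_one hq0 hq1 (h.le_card_sdiff_of_notMem_meetingTwice hcF hab)

lemma sum_meetingOnce_pow_card_sdiff_union_le (h : IsSparse F ℓ M r K) (hℓ : 2 ≤ ℓ)
    (hq0 : 0 ≤ q) (hq : q ≤ r) (hr : r ≤ 1) (ha : a ∈ F) (hb : b ∈ F) :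
    ∑ c ∈ meetingOnce F a, q ^ (c \ (a ∪ b)).card
      ≤ ℓ * M * q ^ (ℓ - 1) + 4 * ℓ ^ 4 * q ^ (ℓ - 2) + (1 + K) := by
  calc ∑ c ∈ meetingOnce F a, q ^ (c \ (a ∪ b)).card
      ≤ (meetingOnce F a).card * q ^ (ℓ - 1)
        + ∑ c ∈ meetingOnce F a, (if c ∈ meetingTwice F (a ∪ b) then q ^ (ℓ - 2) else 0)
        + ∑ c ∈ meetingOnce F a,
          if c ∈ meetingTwice F b then q ^ ((c \ b).card - 1) else 0 := by
        rw [← nsmul_eq_mul, ← Finset.sum_const, ← Finset.sum_add_distrib,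
          ← Finset.sum_add_distrib]
        exact Finset.sum_le_sum fun c hc => h.pow_card_sdiff_union_le hq0 (hq.trans hr) b hc
    _ ≤ (meetingOnce F a).card * q ^ (ℓ - 1) + (meetingTwice F (a ∪ b)).card * q ^ (ℓ - 2)
        + ∑ c ∈ meetingTwice F b, q ^ ((c \ b).card - 1) := by
        rw [← nsmul_eq_mul (meetingTwice _ _).card, ← Finset.sum_const]
        gcongr
        · exact sum_ite_mem_le fun _ _ => pow_nonneg hq0 _
        · exact sum_ite_mem_le fun _ _ => pow_nonneg hq0 _
    _ ≤ _ := by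
        gcongr
        · exact h.card_meetingOnce_le ha
        · exact h.card_meetingTwice_union_le ha hb
        · exact h.sum_meetingTwice_pow_sub_one_le hℓ hb hq0 hq

lemma sum_once_once_le (h : IsSparse F ℓ M r K) (hℓ : 2 ≤ ℓ) (hq0 : 0 ≤ q) (hq : q ≤ r)
    (hr : r ≤ 1) (ha : a ∈ F) :
    ∑ b ∈ meetingOnce F a, ∑ c ∈ meetingOnce F a, q ^ ((b ∪ c) \ a).card
      ≤ ℓ * M * q ^ (ℓ - 1)
        * (ℓ * M * q ^ (ℓ - 1) + 4 * ℓ ^ 4 * q ^ (ℓ - 2) + (1 + K)) := by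
  have hD : 0 ≤ ℓ * M := (Nat.cast_nonneg _).trans (h.card_meetingOnce_le ha)
  have hK : 0 ≤ K := h.nonneg_of_mem (hq0.trans hq) ha
  calc _ = ∑ b ∈ meetingOnce F a, q ^ (ℓ - 1)
          * ∑ c ∈ meetingOnce F a, q ^ (c \ (a ∪ b)).card := by
        refine Finset.sum_congr rfl fun b hb => ?_
        simp only [Finset.mul_sum, card_union_sdiff, pow_add, h.card_sdiff_of_mem_meetingOnce hb]
    _ ≤ ∑ b ∈ meetingOnce F a, q ^ (ℓ - 1)
          * (ℓ * M * q ^ (ℓ - 1) + 4 * ℓ ^ 4 * q ^ (ℓ - 2) + (1 + K)) := by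
        gcongr with b hb
        exact h.sum_meetingOnce_pow_card_sdiff_union_le hℓ hq0 hq hr ha (mem_meetingOnce.1 hb).1
    _ ≤ ℓ * M * (q ^ (ℓ - 1)
          * (ℓ * M * q ^ (ℓ - 1) + 4 * ℓ ^ 4 * q ^ (ℓ - 2) + (1 + K))) := by
        rw [Finset.sum_const, nsmul_eq_mul]
        gcongr
        exact h.card_meetingOnce_le ha
    _ = _ := by ring

lemma sum_meeting_meeting_le (h : IsSparse F ℓ M r K) (hℓ : 2 ≤ ℓ) {L : ℝ} (hq0 : 0 ≤ q)
    (hq : √q ≤ r) (hr : r ≤ 1) (hL : 4 * ℓ ^ 8 * q ^ (ℓ - 2) ≤ L) (ha : a ∈ F) :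
    ∑ b ∈ meeting F a, ∑ c ∈ meeting F a, q ^ ((b ∪ c) \ a).card
      ≤ (ℓ * M * q ^ (ℓ - 1) + 2 * (1 + K) + L) ^ 2 := by
  have hq1 : q ≤ 1 := Real.sqrt_le_one.1 (hq.trans hr)
  have hqr : q ≤ r := ((Real.le_sqrt hq0 hq0).2 (pow_le_of_le_one hq0 hq1 two_ne_zero)).trans hq
  have hsplit : ∑ b ∈ meeting F a, ∑ c ∈ meeting F a, q ^ ((b ∪ c) \ a).card
      = ∑ b ∈ meetingTwice F a, ∑ c ∈ meetingTwice F a, q ^ ((b ∪ c) \ a).card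
        + 2 * ∑ c ∈ meetingTwice F a, ∑ b ∈ meetingOnce F a, q ^ ((b ∪ c) \ a).card
        + ∑ b ∈ meetingOnce F a, ∑ c ∈ meetingOnce F a, q ^ ((b ∪ c) \ a).card := by
    simp only [sum_meeting, Finset.sum_add_distrib]
    rw [Finset.sum_comm (s := meetingOnce F a) (t := meetingTwice F a)]
    simp only [Finset.union_comm]
    ring
  have hℓ1 : (1 : ℝ) ≤ ℓ := by exact_mod_cast (by omega : 1 ≤ ℓ)
  have hL_twice : 4 * ℓ ^ 8 * q ^ (ℓ - 1) ≤ L := by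
    refine le_trans ?_ hL
    exact mul_le_mul_of_nonneg_left (pow_le_pow_of_le_one hq0 hq1 (by omega)) (by positivity)
  have hL_once : 4 * ℓ ^ 4 * q ^ (ℓ - 2) ≤ L := by
    refine le_trans ?_ hL
    gcongr
    norm_num
  have hD : 0 ≤ ℓ * M * q ^ (ℓ - 1) :=
    mul_nonneg ((Nat.cast_nonneg _).trans (h.card_meetingOnce_le ha)) (pow_nonneg hq0 _)
  have hK : 0 ≤ K := h.nonneg_of_mem (hq0.trans hqr) ha
  have hL0 : 0 ≤ L := le_trans (by positivity) hL
  have h22 := h.sum_twice_twice_le hℓ hq0 hq hr ha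
  have h21 := (h.sum_twice_once_le hℓ hq0 hqr hr ha).trans (add_le_add_right hL_twice _)
  have h11 := (h.sum_once_once_le hℓ hq0 hqr hr ha).trans (mul_le_mul_of_nonneg_left
    (add_le_add_left (add_le_add_right hL_once _) _) hD)
  rw [hsplit]
  nlinarith [mul_nonneg hD hL0, mul_nonneg hD hK, mul_nonneg hK hL0, sq_nonneg K, sq_nonneg L]

lemma tripleSum_le (h : IsSparse F ℓ M r K) (hℓ : 2 ≤ ℓ) {L : ℝ} (hq0 : 0 ≤ q) (hq : √q ≤ r)
    (hr : r ≤ 1) (hL : 4 * ℓ ^ 8 * q ^ (ℓ - 2) ≤ L) :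
    tripleSum F q ≤ F.card * q ^ ℓ * (ℓ * M * q ^ (ℓ - 1) + 2 * (1 + K) + L) ^ 2 := by
  rw [tripleSum, mul_assoc, ← nsmul_eq_mul]
  refine Finset.sum_le_card_nsmul _ _ _ fun a ha => ?_
  have hunion (b c) : q ^ (a ∪ b ∪ c).card = q ^ ℓ * q ^ ((b ∪ c) \ a).card := by
    rw [← pow_add, ← h.card_eq a ha, Finset.union_assoc, Finset.union_comm,
      ← Finset.card_sdiff_add_card, add_comm]
  simp only [hunion, ← Finset.mul_sum]
  exact mul_le_mul_of_nonneg_left (h.sum_meeting_meeting_le hℓ hq0 hq hr hL ha) (pow_nonneg hq0 _)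

end IsSparse

end SparseFamilies

section GeometricSums

variable {r : ℝ}

lemma sum_pow_le_inv_one_sub {ι : Type*} (hr0 : 0 ≤ r) (hr1 : r < 1) {s : Finset ι} {ψ : ι → ℕ}
    (f : ℕ → ι) (hf : ∀ i ∈ s, ∃ k ≤ ψ i, f k = i) : ∑ i ∈ s, r ^ ψ i ≤ (1 - r)⁻¹ := by
  choose! k hk hfk using hf
  have hinj : Set.InjOn k s := fun i hi j hj hij => by rw [← hfk i hi, ← hfk j hj, hij]
  calc ∑ i ∈ s, r ^ ψ i ≤ ∑ i ∈ s, r ^ k i :=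
        Finset.sum_le_sum fun i hi => pow_le_pow_of_le_one hr0 hr1.le (hk i hi)
    _ = ∑ j ∈ s.image k, r ^ j := (Finset.sum_image hinj).symm
    _ ≤ ∑' j : ℕ, r ^ j :=
        (summable_geometric_of_lt_one hr0 hr1).sum_le_tsum _ fun _ _ => pow_nonneg hr0 _
    _ = (1 - r)⁻¹ := tsum_geometric_of_lt_one hr0 hr1

lemma exists_pow_mul_pow_sub_le (hr0 : 0 < r) (hr1 : r < 1) (k j : ℕ) :
    ∃ C : ℝ, ∀ m : ℕ, (m : ℝ) ^ k * r ^ (m - j) ≤ C := by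
  have hlim := tendsto_pow_const_mul_const_pow_of_abs_lt_one k
    (by rwa [abs_of_pos hr0] : |r| < 1)
  obtain ⟨C, hC⟩ := hlim.bddAbove_range
  refine ⟨C / r ^ j, fun m => ?_⟩
  rw [le_div_iff₀ (pow_pos hr0 j), mul_assoc, ← pow_add]
  refine le_trans ?_ (hC ⟨m, rfl⟩)
  exact mul_le_mul_of_nonneg_left (pow_le_pow_of_le_one hr0.le hr1.le (by omega)) (by positivity)

end GeometricSums

section ArithmeticProgressions

variable {ℓ n a b a' b' : ℕ}

/-- The arithmetic progression `a, a + b, …, a + (ℓ - 1) b`. -/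
def ap (ℓ a b : ℕ) : Finset ℕ := (Finset.range ℓ).image (fun i => a + i * b)

lemma mem_ap {x : ℕ} : x ∈ ap ℓ a b ↔ ∃ i < ℓ, a + i * b = x := by
  simp [ap]

lemma add_mul_right_injective (a : ℕ) (hb : 0 < b) : Function.Injective (fun i => a + i * b) :=
  fun _ _ hij => Nat.eq_of_mul_eq_mul_right hb (Nat.add_left_cancel hij)

lemma card_ap (ℓ a : ℕ) (hb : 0 < b) : (ap ℓ a b).card = ℓ := by
  rw [ap, Finset.card_image_of_injective _ (add_mul_right_injective a hb), Finset.card_range]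

lemma mem_apSet {T : Finset ℕ} :
    T ∈ apSet ℓ n ↔ T ⊆ Finset.Icc 1 n ∧ ∃ a b, 0 < b ∧ T = ap ℓ a b := by
  simp only [apSet, Finset.mem_filter, Finset.mem_powerset]
  rfl

lemma card_of_mem_apSet {T : Finset ℕ} (hT : T ∈ apSet ℓ n) : T.card = ℓ := by
  obtain ⟨-, a, b, hb, rfl⟩ := mem_apSet.1 hT
  exact card_ap ℓ a hb

lemma apSet_subset_powersetCard (ℓ n : ℕ) : apSet ℓ n ⊆ (Finset.Icc 1 n).powersetCard ℓ :=
  fun _ hT => Finset.mem_powersetCard.2 ⟨(mem_apSet.1 hT).1, card_of_mem_apSet hT⟩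

lemma ap_subset_Icc_iff (hℓ : 1 ≤ ℓ) :
    ap ℓ a b ⊆ Finset.Icc 1 n ↔ 1 ≤ a ∧ a + (ℓ - 1) * b ≤ n := by
  constructor
  · intro h
    have hfirst := Finset.mem_Icc.1 (h (mem_ap.2 ⟨0, hℓ, rfl⟩))
    have hlast := Finset.mem_Icc.1 (h (mem_ap.2 ⟨ℓ - 1, by omega, rfl⟩))
    exact ⟨by simpa using hfirst.1, hlast.2⟩
  · rintro ⟨h1, h2⟩ x hx
    obtain ⟨i, hi, rfl⟩ := mem_ap.1 hx
    have : i * b ≤ (ℓ - 1) * b := Nat.mul_le_mul_right b (by omega)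
    exact Finset.mem_Icc.2 ⟨by omega, by omega⟩

lemma eq_and_eq_of_ap_eq (hℓ : 2 ≤ ℓ) (h : ap ℓ a b = ap ℓ a' b') : a = a' ∧ b = b' := by
  have hmin {a b a' b' : ℕ} (h : ap ℓ a b = ap ℓ a' b') : a' ≤ a := by
    have ha : a ∈ ap ℓ a' b' := h ▸ mem_ap.2 ⟨0, by omega, by simp⟩
    obtain ⟨i, -, hi⟩ := mem_ap.1 ha
    exact hi ▸ Nat.le_add_right _ _
  have hmax {a b a' b' : ℕ} (h : ap ℓ a b = ap ℓ a' b') :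
      a + (ℓ - 1) * b ≤ a' + (ℓ - 1) * b' := by
    have hlast : a + (ℓ - 1) * b ∈ ap ℓ a' b' := h ▸ mem_ap.2 ⟨ℓ - 1, by omega, rfl⟩
    obtain ⟨i, hi, hi'⟩ := mem_ap.1 hlast
    rw [← hi']
    exact Nat.add_le_add_left (Nat.mul_le_mul_right _ (by omega)) _
  obtain rfl : a = a' := le_antisymm (hmin h.symm) (hmin h)
  have hb := le_antisymm (hmax h) (hmax h.symm)
  exact ⟨rfl, Nat.eq_of_mul_eq_mul_left (by omega) (Nat.add_left_cancel hb)⟩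

lemma card_apSet (hℓ : 2 ≤ ℓ) (n : ℕ) :
    (apSet ℓ n).card = ∑ k ∈ Finset.range n, (n - (ℓ - 1) * (k + 1)) := by
  have himage : apSet ℓ n = ((Finset.range n).sigma fun k =>
      Finset.Icc 1 (n - (ℓ - 1) * (k + 1))).image fun x => ap ℓ x.2 (x.1 + 1) := by
    ext T
    rw [mem_apSet, Finset.mem_image]
    constructor
    · rintro ⟨hT, a, b, hb, rfl⟩
      rw [ap_subset_Icc_iff (by omega)] at hT
      have hbn : 1 * b ≤ (ℓ - 1) * b := Nat.mul_le_mul_right b (by omega)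
      refine ⟨⟨b - 1, a⟩, ?_, by rw [Nat.sub_add_cancel hb]⟩
      simp only [Finset.mem_sigma, Finset.mem_range, Finset.mem_Icc, Nat.sub_add_cancel hb]
      omega
    · rintro ⟨⟨k, a⟩, hx, rfl⟩
      simp only [Finset.mem_sigma, Finset.mem_range, Finset.mem_Icc] at hx
      rw [ap_subset_Icc_iff (by omega)]
      exact ⟨⟨hx.2.1, by dsimp only; omega⟩, a, k + 1, by omega, rfl⟩
  rw [himage, Finset.card_image_of_injective, Finset.card_sigma]
  · simp
  · rintro ⟨k, a⟩ ⟨k', a'⟩ h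
    obtain ⟨rfl, hk⟩ := eq_and_eq_of_ap_eq hℓ h
    obtain rfl := Nat.succ_injective hk
    rfl

lemma two_mul_mul_le_sq_sub_sq (m u : ℕ) :
    2 * (m : ℝ) * (u - m : ℕ) ≤ (u : ℝ) ^ 2 - ((u - m : ℕ) : ℝ) ^ 2 := by
  rcases le_total m u with h | h
  · rw [Nat.cast_sub h]
    nlinarith [sq_nonneg (m : ℝ)]
  · simp [Nat.sub_eq_zero_of_le h]

lemma sq_sub_sq_le_two_mul_mul_add (m u : ℕ) :
    (u : ℝ) ^ 2 - ((u - m : ℕ) : ℝ) ^ 2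
      ≤ 2 * (m : ℝ) * (u - m : ℕ) + m * ((u : ℝ) - (u - m : ℕ)) := by
  rcases le_total m u with h | h
  · rw [Nat.cast_sub h]
    nlinarith
  · have hmu : (u : ℝ) ≤ m := by exact_mod_cast h
    simp only [Nat.sub_eq_zero_of_le h, Nat.cast_zero]
    nlinarith

lemma two_mul_mul_card_apSet {m : ℕ} (hm : 1 ≤ m) (n : ℕ) :
    2 * (m : ℝ) * (apSet (m + 1) n).card
      = ∑ k ∈ Finset.range n, 2 * (m : ℝ) * ((n - m * k - m : ℕ) : ℝ) := by
  rw [card_apSet (by omega), Nat.cast_sum, Finset.mul_sum]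
  simp only [Nat.add_sub_cancel, Nat.mul_succ, Nat.sub_sub]

lemma card_apSet_le (hℓ : 2 ≤ ℓ) (n : ℕ) :
    2 * ((ℓ : ℝ) - 1) * (apSet ℓ n).card ≤ n ^ 2 := by
  obtain ⟨m, rfl⟩ : ∃ m, ℓ = m + 1 := ⟨ℓ - 1, by omega⟩
  have hn : n - m * n = 0 := Nat.sub_eq_zero_of_le (Nat.le_mul_of_pos_left n (by omega))
  have hsq := Finset.sum_range_sub' (fun k => ((n - m * k : ℕ) : ℝ) ^ 2) n
  have hsum := Finset.sum_le_sum fun k (_ : k ∈ Finset.range n) =>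
    two_mul_mul_le_sq_sub_sq m (n - m * k)
  rw [← two_mul_mul_card_apSet (by omega)] at hsum
  simp only [Nat.sub_sub, ← Nat.mul_succ] at hsum
  rw [hsq, hn] at hsum
  simpa using hsum

lemma le_card_apSet (hℓ : 2 ≤ ℓ) (n : ℕ) :
    (n : ℝ) ^ 2 - (ℓ - 1) * n ≤ 2 * (ℓ - 1) * (apSet ℓ n).card := by
  obtain ⟨m, rfl⟩ : ∃ m, ℓ = m + 1 := ⟨ℓ - 1, by omega⟩
  have hn : n - m * n = 0 := Nat.sub_eq_zero_of_le (Nat.le_mul_of_pos_left n (by omega))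
  have hsq := Finset.sum_range_sub' (fun k => ((n - m * k : ℕ) : ℝ) ^ 2) n
  have hlin := Finset.sum_range_sub' (fun k => ((n - m * k : ℕ) : ℝ)) n
  have hsum := Finset.sum_le_sum fun k (_ : k ∈ Finset.range n) =>
    sq_sub_sq_le_two_mul_mul_add m (n - m * k)
  rw [Finset.sum_add_distrib, ← two_mul_mul_card_apSet (by omega), ← Finset.mul_sum] at hsum
  simp only [Nat.sub_sub, ← Nat.mul_succ] at hsum
  rw [hsq, hlin, hn] at hsum
  simpa [sub_le_iff_le_add] using hsum

lemma card_apSet_mem_le (hℓ : 2 ≤ ℓ) (n x : ℕ) :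
    ({T ∈ apSet ℓ n | x ∈ T} : Finset (Finset ℕ)).card ≤ 2 * n := by
  have hsub : ({T ∈ apSet ℓ n | x ∈ T} : Finset (Finset ℕ))
      ⊆ (Finset.range ℓ ×ˢ Finset.Icc 1 (n / (ℓ - 1))).image
        (fun y => ap ℓ (x - y.1 * y.2) y.2) := by
    intro T hT
    rw [Finset.mem_filter, mem_apSet] at hT
    obtain ⟨⟨hT, a, b, hb, rfl⟩, hx⟩ := hT
    obtain ⟨i, hi, rfl⟩ := mem_ap.1 hx
    rw [ap_subset_Icc_iff (by omega)] at hT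
    refine Finset.mem_image.2 ⟨(i, b), ?_, by simp⟩
    rw [Finset.mem_product, Finset.mem_range, Finset.mem_Icc, Nat.le_div_iff_mul_le (by omega),
      mul_comm b]
    exact ⟨hi, hb, by omega⟩
  calc _ ≤ ℓ * (n / (ℓ - 1)) := (Finset.card_le_card hsub).trans <| Finset.card_image_le.trans <|
        by rw [Finset.card_product, Finset.card_range, Nat.card_Icc, Nat.add_sub_cancel]
    _ ≤ 2 * (ℓ - 1) * (n / (ℓ - 1)) := Nat.mul_le_mul_right _ (by omega)
    _ = 2 * ((ℓ - 1) * (n / (ℓ - 1))) := by ring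
    _ ≤ 2 * n := Nat.mul_le_mul_left _ (Nat.mul_div_le _ _)

lemma card_apSet_mem_mem_le (ℓ n : ℕ) {x y : ℕ} (hxy : x ≠ y) :
    ({T ∈ apSet ℓ n | x ∈ T ∧ y ∈ T} : Finset (Finset ℕ)).card ≤ ℓ ^ 2 := by
  -- the positions `i, j` of `x, y` determine the progression: `b = (y - x) / (j - i)`
  have hsub : ({T ∈ apSet ℓ n | x ∈ T ∧ y ∈ T} : Finset (Finset ℕ))
      ⊆ (Finset.range ℓ ×ˢ Finset.range ℓ).image
        (fun k => ap ℓ (x - k.1 * (((y : ℤ) - x) / (k.2 - k.1)).toNat)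
          (((y : ℤ) - x) / (k.2 - k.1)).toNat) := by
    intro T hT
    rw [Finset.mem_filter, mem_apSet] at hT
    obtain ⟨⟨-, a, b, -, rfl⟩, hx, hy⟩ := hT
    obtain ⟨i, hi, rfl⟩ := mem_ap.1 hx
    obtain ⟨j, hj, rfl⟩ := mem_ap.1 hy
    refine Finset.mem_image.2 ⟨(i, j), by simp [hi, hj], ?_⟩
    have hij : (j : ℤ) - i ≠ 0 := by
      rintro h
      obtain rfl : i = j := by omega
      exact hxy rfl
    have hdiff : (((a + j * b : ℕ) : ℤ) - (a + i * b : ℕ)) / (j - i) = b := by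
      have : ((a + j * b : ℕ) : ℤ) - (a + i * b : ℕ) = (j - i) * b := by push_cast; ring
      rw [this, Int.mul_ediv_cancel_left _ hij]
    simp only [hdiff, Int.toNat_natCast, Nat.add_sub_cancel]
  calc _ ≤ _ := (Finset.card_le_card hsub).trans Finset.card_image_le
    _ = ℓ ^ 2 := by rw [Finset.card_product, Finset.card_range, sq]

lemma card_le_of_succ_notMem {I : Finset ℕ} (hI : I ⊆ Finset.range ℓ)
    (hsucc : ∀ i ∈ I, i + 1 ∉ I) : I.card ≤ (ℓ + 1) / 2 := by
  rw [← Finset.card_range ((ℓ + 1) / 2)]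
  refine Finset.card_le_card_of_injOn (fun i => i / 2) (fun i hi => ?_) fun i hi j hj hij => ?_
  · have := Finset.mem_range.1 (hI hi)
    simp only [Finset.coe_range, Set.mem_Iio]
    omega
  · dsimp only at hij
    by_contra hne
    rcases Nat.lt_or_gt_of_ne hne with h | h
    · exact hsucc i hi ((by omega : j = i + 1) ▸ hj)
    · exact hsucc j hj ((by omega : i = j + 1) ▸ hi)

lemma two_mul_card_ap_inter_le_of_lt (hb : 0 < b) (hlt : b < b') :
    2 * (ap ℓ a b ∩ ap ℓ a' b').card ≤ ℓ + 1 := by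
  set I := {i ∈ Finset.range ℓ | a + i * b ∈ ap ℓ a' b'}
  have hsucc : ∀ i ∈ I, i + 1 ∉ I := by
    intro i hi hi'
    obtain ⟨j, -, hj⟩ := mem_ap.1 (Finset.mem_filter.1 hi).2
    obtain ⟨j', -, hj'⟩ := mem_ap.1 (Finset.mem_filter.1 hi').2
    have hstep : j' * b' = j * b' + b := by rw [Nat.add_mul] at hj'; omega
    have hlt' : j < j' := Nat.lt_of_mul_lt_mul_right (a := b') (by omega)
    have hle : (j + 1) * b' ≤ j' * b' := Nat.mul_le_mul_right _ hlt'
    rw [Nat.add_mul] at hle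
    omega
  have hinter : ap ℓ a b ∩ ap ℓ a' b' ⊆ I.image fun i => a + i * b := by
    intro x hx
    obtain ⟨hx, hx'⟩ := Finset.mem_inter.1 hx
    obtain ⟨i, hi, rfl⟩ := mem_ap.1 hx
    exact Finset.mem_image.2 ⟨i, Finset.mem_filter.2 ⟨Finset.mem_range.2 hi, hx'⟩, rfl⟩
  have hle := (Finset.card_le_card hinter).trans Finset.card_image_le
  have hI : I.card ≤ (ℓ + 1) / 2 := card_le_of_succ_notMem (Finset.filter_subset _ _) hsucc
  omega

lemma two_mul_card_ap_inter_le (hb : 0 < b) (hb' : 0 < b') (hne : b ≠ b') :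
    2 * (ap ℓ a b ∩ ap ℓ a' b').card ≤ ℓ + 1 := by
  rcases Nat.lt_or_gt_of_ne hne with h | h
  · exact two_mul_card_ap_inter_le_of_lt hb h
  · rw [Finset.inter_comm]
    exact two_mul_card_ap_inter_le_of_lt hb' h

lemma le_card_ap_add_sdiff {k : ℕ} (hb : 0 < b) (hk : k ≤ ℓ) :
    k ≤ (ap ℓ (a + k * b) b \ ap ℓ a b).card := by
  calc k = ((Finset.Ico (ℓ - k) ℓ).image (fun i => (a + k * b) + i * b)).card := by
        rw [Finset.card_image_of_injective _ (add_mul_right_injective _ hb), Nat.card_Ico]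
        omega
    _ ≤ _ := Finset.card_le_card fun x hx => by
        obtain ⟨i, hi, rfl⟩ := Finset.mem_image.1 hx
        rw [Finset.mem_Ico] at hi
        refine Finset.mem_sdiff.2 ⟨mem_ap.2 ⟨i, hi.2, rfl⟩, fun h => ?_⟩
        obtain ⟨j, hj, hj'⟩ := mem_ap.1 h
        rw [add_assoc, ← add_mul] at hj'
        have := add_mul_right_injective a hb hj'
        omega

lemma exists_eq_add_mul_of_not_disjoint_ap (hb : 0 < b) (hlt : a < a')
    (h : ¬ Disjoint (ap ℓ a b) (ap ℓ a' b)) :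
    ∃ k < (ap ℓ a' b \ ap ℓ a b).card, a' = a + (k + 1) * b := by
  obtain ⟨x, hx, hx'⟩ := Finset.not_disjoint_iff.1 h
  obtain ⟨i, hi, rfl⟩ := mem_ap.1 hx
  obtain ⟨j, -, hj'⟩ := mem_ap.1 hx'
  have hji : j < i := Nat.lt_of_mul_lt_mul_right (a := b) (by omega)
  have ha' : a' = a + (i - j - 1 + 1) * b := by
    rw [Nat.sub_add_cancel (by omega), Nat.sub_mul]
    omega
  refine ⟨i - j - 1, ?_, ha'⟩
  rw [ha']
  exact le_card_ap_add_sdiff hb (by omega)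

end ArithmeticProgressions

section SparseProgressions

variable {ℓ n a b : ℕ} {r : ℝ}

lemma sum_pow_le_of_shift_up (hr0 : 0 ≤ r) (hr1 : r < 1) (hb : 0 < b) {G : Finset (Finset ℕ)}
    (hG : ∀ c ∈ G, ¬ Disjoint (ap ℓ a b) c ∧ ∃ a', a < a' ∧ c = ap ℓ a' b) :
    ∑ c ∈ G, r ^ ((c \ ap ℓ a b).card - 1) ≤ (1 - r)⁻¹ := by
  refine sum_pow_le_inv_one_sub hr0 hr1 (fun k => ap ℓ (a + (k + 1) * b) b) fun c hc => ?_
  obtain ⟨hdisj, a', hlt, rfl⟩ := hG c hc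
  obtain ⟨k, hk, rfl⟩ := exists_eq_add_mul_of_not_disjoint_ap hb hlt hdisj
  exact ⟨k, by omega, rfl⟩

lemma sum_pow_le_of_shift_down (hr0 : 0 ≤ r) (hr1 : r < 1) (hb : 0 < b)
    {G : Finset (Finset ℕ)}
    (hG : ∀ c ∈ G, ¬ Disjoint (ap ℓ a b) c ∧ ∃ a', a' < a ∧ c = ap ℓ a' b) :
    ∑ c ∈ G, r ^ ((c \ ap ℓ a b).card - 1) ≤ (1 - r)⁻¹ := by
  refine sum_pow_le_inv_one_sub hr0 hr1 (fun k => ap ℓ (a - (k + 1) * b) b) fun c hc => ?_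
  obtain ⟨hdisj, a', hlt, rfl⟩ := hG c hc
  obtain ⟨k, hk, hak⟩ := exists_eq_add_mul_of_not_disjoint_ap hb hlt fun h => hdisj h.symm
  rw [Finset.card_sdiff_comm (by rw [card_ap ℓ a hb, card_ap ℓ a' hb])] at hk
  exact ⟨k, by omega, by rw [hak, Nat.add_sub_cancel]⟩

lemma exists_pow_four_mul_pow_half_le (hr0 : 0 < r) (hr1 : r < 1) :
    ∃ C : ℝ, ∀ ℓ : ℕ, 2 ≤ ℓ → (ℓ : ℝ) ^ 4 * r ^ (ℓ / 2 - 1) ≤ C := by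
  obtain ⟨C, hC⟩ := exists_pow_mul_pow_sub_le hr0 hr1 4 1
  refine ⟨81 * C, fun ℓ hℓ => ?_⟩
  have hhalf : (ℓ : ℝ) ≤ 3 * ((ℓ / 2 : ℕ) : ℝ) := by exact_mod_cast (by omega : ℓ ≤ 3 * (ℓ / 2))
  calc (ℓ : ℝ) ^ 4 * r ^ (ℓ / 2 - 1) ≤ (3 * ((ℓ / 2 : ℕ) : ℝ)) ^ 4 * r ^ (ℓ / 2 - 1) := by gcongr
    _ = 81 * (((ℓ / 2 : ℕ) : ℝ) ^ 4 * r ^ (ℓ / 2 - 1)) := by ring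
    _ ≤ 81 * C := by gcongr; exact hC _

lemma half_le_card_sdiff_ap {c : Finset ℕ} (hb : 0 < b) (hc : c ∈ apSet ℓ n)
    (hne : ∀ a', c ≠ ap ℓ a' b) : ℓ / 2 ≤ (c \ ap ℓ a b).card := by
  obtain ⟨-, a', b', hb', rfl⟩ := mem_apSet.1 hc
  have hinter := two_mul_card_ap_inter_le (ℓ := ℓ) (a := a') (a' := a) hb' hb
    fun h => hne a' (by rw [h])
  have hcard := Finset.card_inter_add_card_sdiff (ap ℓ a' b') (ap ℓ a b)
  rw [card_ap ℓ a' hb'] at hcard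
  omega

lemma sum_pow_le_pow_four_mul {G : Finset (Finset ℕ)} {T : Finset ℕ} (hr0 : 0 ≤ r) (hr1 : r ≤ 1)
    (hcard : (G.card : ℝ) ≤ ℓ ^ 4) (hG : ∀ c ∈ G, ℓ / 2 ≤ (c \ T).card) :
    ∑ c ∈ G, r ^ ((c \ T).card - 1) ≤ ℓ ^ 4 * r ^ (ℓ / 2 - 1) := by
  calc ∑ c ∈ G, r ^ ((c \ T).card - 1) ≤ G.card * r ^ (ℓ / 2 - 1) := by
        rw [← nsmul_eq_mul]
        exact Finset.sum_le_card_nsmul _ _ _ fun c hc =>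
          pow_le_pow_of_le_one hr0 hr1 (Nat.sub_le_sub_right (hG c hc) 1)
    _ ≤ ℓ ^ 4 * r ^ (ℓ / 2 - 1) := by gcongr

lemma sum_erase_meetingTwice_apSet_le (hr0 : 0 ≤ r) (hr1 : r < 1) (hb : 0 < b) :
    ∑ c ∈ (meetingTwice (apSet ℓ n) (ap ℓ a b)).erase (ap ℓ a b),
      r ^ ((c \ ap ℓ a b).card - 1)
      ≤ (1 - r)⁻¹ + ((1 - r)⁻¹ + ℓ ^ 4 * r ^ (ℓ / 2 - 1)) := by
  classical
  set G := (meetingTwice (apSet ℓ n) (ap ℓ a b)).erase (ap ℓ a b)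
  have hdisj : ∀ c ∈ G, ¬ Disjoint (ap ℓ a b) c := fun c hc => by
    have := (mem_meetingTwice.1 (Finset.mem_of_mem_erase hc)).2
    exact not_disjoint_iff_card_inter_pos.2 (by omega)
  have hcard : (G.card : ℝ) ≤ ℓ ^ 4 := by
    have hle := card_meetingTwice_le (fun _ _ => card_apSet_mem_mem_le ℓ n) (ap ℓ a b)
    rw [card_ap ℓ a hb, ← pow_add] at hle
    exact_mod_cast (Finset.card_erase_le).trans hle
  rw [← Finset.sum_filter_add_sum_filter_not G fun c => ∃ a', a < a' ∧ c = ap ℓ a' b,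
    ← Finset.sum_filter_add_sum_filter_not (G.filter fun c => ¬ ∃ a', a < a' ∧ c = ap ℓ a' b)
      fun c => ∃ a', a' < a ∧ c = ap ℓ a' b]
  refine add_le_add ?_ (add_le_add ?_ ?_)
  · refine sum_pow_le_of_shift_up hr0 hr1 hb fun c hc => ?_
    rw [Finset.mem_filter] at hc
    exact ⟨hdisj c hc.1, hc.2⟩
  · refine sum_pow_le_of_shift_down hr0 hr1 hb fun c hc => ?_
    rw [Finset.mem_filter, Finset.mem_filter] at hc
    exact ⟨hdisj c hc.1.1, hc.2⟩
  · refine sum_pow_le_pow_four_mul hr0 hr1.le (le_trans ?_ hcard) fun c hc => ?_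
    · exact_mod_cast Finset.card_le_card
        ((Finset.filter_subset _ _).trans (Finset.filter_subset _ _))
    · rw [Finset.mem_filter, Finset.mem_filter] at hc
      obtain ⟨⟨hc, hup⟩, hdown⟩ := hc
      obtain ⟨hne, hc⟩ := Finset.mem_erase.1 hc
      refine half_le_card_sdiff_ap hb (mem_meetingTwice.1 hc).1 ?_
      rintro a' rfl
      rcases lt_trichotomy a a' with h | rfl | h
      · exact hup ⟨a', h, rfl⟩
      · exact hne rfl
      · exact hdown ⟨a', h, rfl⟩

lemma exists_isSparse_apSet (hr0 : 0 < r) (hr1 : r < 1) :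
    ∃ K : ℝ, ∀ ℓ n : ℕ, 2 ≤ ℓ → IsSparse (apSet ℓ n) ℓ (2 * n) r K := by
  obtain ⟨C, hC⟩ := exists_pow_four_mul_pow_half_le hr0 hr1
  refine ⟨(1 - r)⁻¹ + ((1 - r)⁻¹ + C), fun ℓ n hℓ => ⟨fun _ => card_of_mem_apSet, fun x => ?_,
    fun _ _ => card_apSet_mem_mem_le ℓ n, fun T hT => ?_⟩⟩
  · exact_mod_cast card_apSet_mem_le hℓ n x
  · obtain ⟨-, a, b, hb, rfl⟩ := mem_apSet.1 hT
    refine (sum_erase_meetingTwice_apSet_le hr0.le hr1 hb).trans ?_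
    gcongr
    exact hC ℓ hℓ

end SparseProgressions

section ProgressionCount

variable {ℓ n : ℕ} {p : unitInterval} {q r K : ℝ}

/-- The expected number of progressions of length `ℓ` in a random subset of `{1, …, n}` which
contains every element with probability `q`. -/
noncomputable def apMean (ℓ n : ℕ) (q : ℝ) : ℝ := (apSet ℓ n).card * q ^ ℓ

/-- The quantity `n ^ 2 q ^ ℓ / (ℓ - 1)` which governs the limit law of the number of progressions;
it is asymptotically twice the mean. -/
noncomputable def apIntensity (ℓ n : ℕ) (q : ℝ) : ℝ := (n : ℝ) ^ 2 * q ^ ℓ / ((ℓ : ℝ) - 1)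

/-- A bound for the expected number of progressions which meet a given one in a single point, given
that this point is chosen: each of the `ℓ` points lies in at most `2 n` progressions. -/
noncomputable def apDegree (ℓ n : ℕ) (q : ℝ) : ℝ := ℓ * (2 * n) * q ^ (ℓ - 1)

/-- The variance of the number of progressions of length `ℓ` in `[n]_p`. -/
noncomputable def apVariance (ℓ n : ℕ) (p : unitInterval) : ℝ :=
  Var[fun S => (numAP ℓ n S : ℝ); randomSubset n p]

lemma coe_subset_Icc_of_mem_apSet {T : Finset ℕ} (hT : T ∈ apSet ℓ n) :
    (T : Set ℕ) ⊆ Set.Icc 1 n := by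
  rw [← Finset.coe_Icc]
  exact Finset.coe_subset.2 (mem_apSet.1 hT).1

lemma numAP_cast (ℓ n : ℕ) (S : Set ℕ) :
    (numAP ℓ n S : ℝ) = ∑ T ∈ apSet ℓ n, containsInd T S := by
  classical
  rw [numAP, Nat.cast_sum]
  refine Finset.sum_congr rfl fun T _ => ?_
  simp only [containsInd, Set.indicator_apply, Set.mem_ofPred_eq, Pi.one_apply, Nat.cast_ite,
    Nat.cast_one, Nat.cast_zero]

lemma measurable_numAP (ℓ n : ℕ) : Measurable (numAP ℓ n) :=
  Finset.measurable_sum _ fun T _ =>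
    Measurable.ite (measurableSet_superset T) measurable_const measurable_const

lemma integrable_numAP (ℓ n : ℕ) (p : unitInterval) :
    Integrable (fun S => (numAP ℓ n S : ℝ)) (randomSubset n p) := by
  simp only [numAP_cast]
  exact integrable_finsetSum _ fun T _ => integrable_containsInd T

lemma sum_apSet_pow_card (ℓ n : ℕ) (q : ℝ) : ∑ T ∈ apSet ℓ n, q ^ T.card = apMean ℓ n q := by
  rw [Finset.sum_congr rfl fun T hT => by rw [card_of_mem_apSet hT], Finset.sum_const,
    nsmul_eq_mul, apMean]

lemma integral_numAP (ℓ n : ℕ) (p : unitInterval) :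
    ∫ S, (numAP ℓ n S : ℝ) ∂(randomSubset n p) = apMean ℓ n p := by
  simp only [numAP_cast]
  rw [integral_finsetSum _ fun T _ => integrable_containsInd T, ← sum_apSet_pow_card]
  exact Finset.sum_congr rfl fun T hT => integral_containsInd (coe_subset_Icc_of_mem_apSet hT)

lemma apMean_nonneg (hq : 0 ≤ q) : 0 ≤ apMean ℓ n q := by
  unfold apMean
  positivity

lemma apDegree_nonneg (hq : 0 ≤ q) : 0 ≤ apDegree ℓ n q := by
  unfold apDegree
  positivity

lemma two_mul_apMean_le (hℓ : 2 ≤ ℓ) (hq : 0 ≤ q) : 2 * apMean ℓ n q ≤ apIntensity ℓ n q := by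
  have hℓ' : (2 : ℝ) ≤ ℓ := by exact_mod_cast hℓ
  rw [apMean, apIntensity, le_div_iff₀ (by linarith)]
  calc 2 * ((apSet ℓ n).card * q ^ ℓ) * (ℓ - 1)
      = 2 * ((ℓ : ℝ) - 1) * (apSet ℓ n).card * q ^ ℓ := by ring
    _ ≤ n ^ 2 * q ^ ℓ := by gcongr; exact card_apSet_le hℓ n

lemma le_two_mul_apMean (hℓ : 2 ≤ ℓ) (hn : 0 < n) (hq : 0 ≤ q) :
    apIntensity ℓ n q * (1 - ℓ / n) ≤ 2 * apMean ℓ n q := by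
  have hℓ' : (2 : ℝ) ≤ ℓ := by exact_mod_cast hℓ
  rw [apMean, apIntensity, div_mul_eq_mul_div, div_le_iff₀ (by linarith)]
  calc (n : ℝ) ^ 2 * q ^ ℓ * (1 - ℓ / n) = (n ^ 2 - ℓ * n) * q ^ ℓ := by field_simp
    _ ≤ (n ^ 2 - (ℓ - 1) * n) * q ^ ℓ := by gcongr; linarith
    _ ≤ 2 * (ℓ - 1) * (apSet ℓ n).card * q ^ ℓ := by gcongr; exact le_card_apSet hℓ n
    _ = 2 * ((apSet ℓ n).card * q ^ ℓ) * (ℓ - 1) := by ring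

lemma apDegree_le (hℓ : 2 ≤ ℓ) (hn : 0 < n) (hq : 0 < q) :
    apDegree ℓ n q ≤ 2 * (apIntensity ℓ n q * (ℓ ^ 2 / (n * q))) := by
  have hℓ' : (2 : ℝ) ≤ ℓ := by exact_mod_cast hℓ
  have hℓ0 : (ℓ : ℝ) - 1 ≠ 0 := by linarith
  have hpow : q ^ ℓ = q ^ (ℓ - 1) * q := by rw [← pow_succ, Nat.sub_add_cancel (by omega)]
  calc apDegree ℓ n q ≤ apDegree ℓ n q * (ℓ / (ℓ - 1)) :=
        le_mul_of_one_le_right (apDegree_nonneg hq.le)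
          ((one_le_div (by linarith)).2 (by linarith))
    _ = 2 * (apIntensity ℓ n q * (ℓ ^ 2 / (n * q))) := by
        rw [apDegree, apIntensity, hpow]
        field_simp

lemma one_sub_mul_apMean_le_apVariance (hℓ : 1 ≤ ℓ) :
    (1 - (p : ℝ)) * apMean ℓ n p ≤ apVariance ℓ n p := by
  simp only [apVariance, numAP_cast]
  refine le_trans ?_ (sum_pow_mul_le_variance fun _ => coe_subset_Icc_of_mem_apSet)
  rw [← sum_apSet_pow_card, Finset.mul_sum]
  refine Finset.sum_le_sum fun T hT => ?_
  have hle : (p : ℝ) ^ T.card ≤ p :=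
    pow_le_of_le_one p.2.1 p.2.2 (by rw [card_of_mem_apSet hT]; omega)
  rw [mul_comm]
  exact mul_le_mul_of_nonneg_left (by linarith) (pow_nonneg p.2.1 _)

lemma one_sub_mul_cube_mul_pow_le_apVariance (hℓ : 2 ≤ ℓ) (hℓn : 2 * ℓ ≤ n) :
    (1 - (p : ℝ)) * ((n : ℝ) ^ 3 * (p : ℝ) ^ (2 * ℓ - 1)) ≤ 16 * apVariance ℓ n p := by
  have hn : (0 : ℝ) < n := by exact_mod_cast (by omega : 0 < n)
  have hℓn' : 2 * (ℓ : ℝ) ≤ n := by exact_mod_cast hℓn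
  have hcard : (n : ℝ) ^ 2 / 4 ≤ (apSet ℓ n).card * ℓ := by
    have := le_card_apSet hℓ n
    nlinarith [(apSet ℓ n).card.cast_nonneg (α := ℝ)]
  have hvar := pow_mul_sq_card_mul_le_variance (p := p) (apSet_subset_powersetCard ℓ n)
  rw [Nat.card_Icc, Nat.add_sub_cancel, Finset.coe_Icc] at hvar
  simp only [apVariance, numAP_cast]
  have hp : 0 ≤ 1 - (p : ℝ) := sub_nonneg.2 p.2.2
  have hpow : 0 ≤ (p : ℝ) ^ (2 * ℓ - 1) := pow_nonneg p.2.1 _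
  refine le_of_mul_le_mul_left ?_ hn
  calc (n : ℝ) * ((1 - p) * (n ^ 3 * (p : ℝ) ^ (2 * ℓ - 1)))
      = 16 * ((p : ℝ) ^ (2 * ℓ - 1) * (1 - p) * (n ^ 2 / 4) ^ 2) := by ring
    _ ≤ 16 * ((p : ℝ) ^ (2 * ℓ - 1) * (1 - p) * ((apSet ℓ n).card * ℓ) ^ 2) := by gcongr
    _ ≤ _ := by linarith

lemma sq_apMean_mul_sq_apDegree_le (hℓ : 2 ≤ ℓ) (hq : 0 ≤ q) :
    (apMean ℓ n q * apDegree ℓ n q ^ 2) ^ 2 * (n * q)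
      ≤ 16 * ℓ ^ 2 * (n ^ 3 * q ^ (2 * ℓ - 1)) ^ 3 := by
  obtain ⟨m, rfl⟩ : ∃ m, ℓ = m + 1 := ⟨ℓ - 1, by omega⟩
  have hcard : ((apSet (m + 1) n).card : ℝ) * (m + 1 : ℕ) ≤ n ^ 2 := by
    have hle := card_apSet_le hℓ n
    have hm : (2 : ℝ) ≤ (m + 1 : ℕ) := by exact_mod_cast hℓ
    nlinarith [(apSet (m + 1) n).card.cast_nonneg (α := ℝ)]
  rw [apMean, apDegree, Nat.add_sub_cancel, (by omega : 2 * (m + 1) - 1 = 2 * m + 1)]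
  calc _ = (((apSet (m + 1) n).card : ℝ) * (m + 1 : ℕ)) ^ 2
        * (16 * (m + 1 : ℕ) ^ 2 * n ^ 5 * q ^ (6 * m + 3)) := by ring
    _ ≤ (n ^ 2) ^ 2 * (16 * (m + 1 : ℕ) ^ 2 * n ^ 5 * q ^ (6 * m + 3)) := by gcongr
    _ = _ := by ring

lemma exists_tripleSum_apSet_le (hr0 : 0 < r) (hr1 : r < 1) :
    ∃ C : ℝ, ∀ ℓ n : ℕ, ∀ q : ℝ, 2 ≤ ℓ → 0 ≤ q → q ≤ r →
      tripleSum (apSet ℓ n) q ≤ apMean ℓ n q * (apDegree ℓ n q + C) ^ 2 := by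
  have hs0 : 0 < √r := Real.sqrt_pos.2 hr0
  have hs1 : √r < 1 := by rwa [Real.sqrt_lt' one_pos, one_pow]
  obtain ⟨K, hK⟩ := exists_isSparse_apSet hs0 hs1
  obtain ⟨L, hL⟩ := exists_pow_mul_pow_sub_le hr0 hr1 8 2
  refine ⟨2 * (1 + K) + 4 * L, fun ℓ n q hℓ hq0 hq => ?_⟩
  have hL' : 4 * (ℓ : ℝ) ^ 8 * q ^ (ℓ - 2) ≤ 4 * L := by
    calc 4 * (ℓ : ℝ) ^ 8 * q ^ (ℓ - 2) ≤ 4 * (ℓ : ℝ) ^ 8 * r ^ (ℓ - 2) := by gcongr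
      _ = 4 * ((ℓ : ℝ) ^ 8 * r ^ (ℓ - 2)) := mul_assoc _ _ _
      _ ≤ 4 * L := by gcongr; exact hL ℓ
  rw [← add_assoc]
  exact (hK ℓ n hℓ).tripleSum_le hℓ hq0 (Real.sqrt_le_sqrt hq) hs1.le hL'

end ProgressionCount

section Growth

variable {ℓ : ℕ → ℕ} {p : ℕ → unitInterval} {r c : ℝ}

lemma tendsto_zero_of_pow {ι : Type*} {l : Filter ι} {y : ι → ℝ} {k : ℕ} (hk : k ≠ 0)
    (h : Tendsto (fun i => y i ^ k) l (𝓝 0)) : Tendsto y l (𝓝 0) := by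
  rw [← Asymptotics.isLittleO_one_iff ℝ] at h ⊢
  exact .of_pow (by simpa only [Pi.pow_def, one_pow] using h) hk

lemma eventually_le_sq_mul_pow (hℓ : ∀ᶠ n in atTop, 2 ≤ ℓ n) (hc : 0 ≤ c)
    (h : ∀ᶠ n in atTop, c ≤ apIntensity (ℓ n) n (p n)) :
    ∀ᶠ n : ℕ in atTop, c ≤ (n : ℝ) ^ 2 * (p n : ℝ) ^ ℓ n := by
  filter_upwards [hℓ, h] with n hn hcn
  have hn' : (2 : ℝ) ≤ ℓ n := by exact_mod_cast hn
  rw [apIntensity, le_div_iff₀ (by linarith)] at hcn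
  nlinarith

-- `c ≤ n ^ 2 * r ^ ℓ` forces `ℓ` to grow at most logarithmically in `n`.
lemma tendsto_pow_div_natCast_zero (hr0 : 0 < r) (hr1 : r < 1)
    (hp : ∀ᶠ n in atTop, (p n : ℝ) ≤ r) (hc : 0 < c)
    (h : ∀ᶠ n : ℕ in atTop, c ≤ (n : ℝ) ^ 2 * (p n : ℝ) ^ ℓ n) (k : ℕ) :
    Tendsto (fun n : ℕ => (ℓ n : ℝ) ^ k / n) atTop (𝓝 0) := by
  obtain ⟨C, hC⟩ := exists_pow_mul_pow_sub_le hr0 hr1 (3 * k) 0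
  refine tendsto_zero_of_pow three_ne_zero ?_
  refine squeeze_zero' (.of_forall fun n => by positivity) ?_
    (tendsto_const_div_atTop_nhds_zero_nat (C / c))
  filter_upwards [hp, h, eventually_gt_atTop 0] with n hpn hcn hn
  have hp0 : (0 : ℝ) ≤ p n := (p n).2.1
  have hle : (ℓ n : ℝ) ^ (3 * k) * c ≤ n ^ 2 * C := by
    calc (ℓ n : ℝ) ^ (3 * k) * c ≤ (ℓ n : ℝ) ^ (3 * k) * (n ^ 2 * r ^ ℓ n) := by
          gcongr
          exact hcn.trans (by gcongr)
      _ = n ^ 2 * ((ℓ n : ℝ) ^ (3 * k) * r ^ (ℓ n - 0)) := by rw [Nat.sub_zero]; ring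
      _ ≤ n ^ 2 * C := by gcongr; exact hC _
  rw [div_pow, ← pow_mul, mul_comm k, div_div, div_le_div_iff₀ (by positivity) (by positivity)]
  nlinarith

lemma tendsto_sq_div_natCast_mul_zero (hℓ : ∀ᶠ n in atTop, 3 ≤ ℓ n) (hr0 : 0 < r) (hr1 : r < 1)
    (hp : ∀ᶠ n in atTop, (p n : ℝ) ≤ r) (hc : 0 < c)
    (h : ∀ᶠ n : ℕ in atTop, c ≤ (n : ℝ) ^ 2 * (p n : ℝ) ^ ℓ n) :
    Tendsto (fun n : ℕ => (ℓ n : ℝ) ^ 2 / (n * p n)) atTop (𝓝 0) := by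
  have hlim := (tendsto_pow_div_natCast_zero hr0 hr1 hp hc h 6).const_mul c⁻¹
  rw [mul_zero] at hlim
  have hp0 (n) : (0 : ℝ) ≤ p n := (p n).2.1
  refine tendsto_zero_of_pow three_ne_zero ?_
  refine squeeze_zero' (.of_forall fun n => ?_) ?_ hlim
  · have := hp0 n
    positivity
  filter_upwards [hℓ, h, eventually_gt_atTop 0] with n hn hcn hn0
  have hcube : c * n ≤ (n * p n : ℝ) ^ 3 := by
    calc c * n ≤ (n : ℝ) ^ 2 * (p n : ℝ) ^ ℓ n * n := by gcongr
      _ ≤ (n : ℝ) ^ 2 * (p n : ℝ) ^ 3 * n := by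
        gcongr ?_ * ?_ * _
        exact pow_le_pow_of_le_one (hp0 n) (p n).2.2 hn
      _ = (n * p n : ℝ) ^ 3 := by ring
  calc ((ℓ n : ℝ) ^ 2 / (n * p n)) ^ 3 = (ℓ n : ℝ) ^ 6 / (n * p n) ^ 3 := by
        rw [div_pow]; ring
    _ ≤ (ℓ n : ℝ) ^ 6 / (c * n) := by gcongr
    _ = c⁻¹ * ((ℓ n : ℝ) ^ 6 / n) := by field_simp

lemma eventually_pos_of_le_sq_mul_pow (hℓ : ∀ᶠ n in atTop, ℓ n ≠ 0) (hc : 0 < c)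
    (h : ∀ᶠ n : ℕ in atTop, c ≤ (n : ℝ) ^ 2 * (p n : ℝ) ^ ℓ n) :
    ∀ᶠ n in atTop, (0 : ℝ) < p n := by
  filter_upwards [hℓ, h] with n hn hcn
  refine (p n).2.1.lt_of_ne' fun h0 => ?_
  rw [h0, zero_pow hn, mul_zero] at hcn
  exact hc.not_ge hcn

end Growth

section PoissonLimit

open Complex

variable {ℓ : ℕ → ℕ} {p : ℕ → unitInterval} {c : ℝ}

lemma norm_charFun_numAP_sub_poisson_le {ℓ n : ℕ} {p : unitInterval} {r K : ℝ} (hℓ : 2 ≤ ℓ)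
    (hF : IsSparse (apSet ℓ n) ℓ (2 * n) r K) (hp : (p : ℝ) ≤ r) (t : ℝ) :
    ‖charFun ((randomSubset n p).map fun S => (numAP ℓ n S : ℝ)) t
        - cexp (apMean ℓ n p * (cexp (t * I) - 1))‖
      ≤ t ^ 2 * Real.exp (2 * apMean ℓ n p)
        * (apMean ℓ n p * (2 * apDegree ℓ n p + p * K)) := by
  have hp0 : (0 : ℝ) ≤ p := p.2.1
  have hbound := norm_charFun_map_sum_containsInd_sub_poisson_le (p := p) (F := apSet ℓ n)
    (fun _ => coe_subset_Icc_of_mem_apSet)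
    (fun T hT => Finset.card_pos.1 (by rw [card_of_mem_apSet hT]; omega)) t
  simp only [numAP_cast]
  rw [sum_apSet_pow_card] at hbound
  refine hbound.trans ?_
  gcongr
  rw [apMean, mul_assoc, ← nsmul_eq_mul]
  refine Finset.sum_le_card_nsmul _ _ _ fun T hT => ?_
  have hother := hF.sum_erase_meeting_pow_le hℓ hT hp0 hp
  have hindep : ∑ T' ∈ meeting (apSet ℓ n) T, (p : ℝ) ^ T.card * (p : ℝ) ^ T'.card
      ≤ (p : ℝ) ^ ℓ * apDegree ℓ n p := by
    have hcard := hF.card_meeting_le T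
    rw [card_of_mem_apSet hT] at hcard ⊢
    calc ∑ T' ∈ meeting (apSet ℓ n) T, (p : ℝ) ^ ℓ * (p : ℝ) ^ T'.card
        = (meeting (apSet ℓ n) T).card * ((p : ℝ) ^ ℓ * (p : ℝ) ^ ℓ) := by
          rw [← nsmul_eq_mul, ← Finset.sum_const]
          exact Finset.sum_congr rfl fun T' hT' => by
            rw [card_of_mem_apSet (meeting_subset _ _ hT')]
      _ ≤ ℓ * (2 * n) * ((p : ℝ) ^ ℓ * (p : ℝ) ^ (ℓ - 1)) := by
          gcongr ?_ * (_ * ?_)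
          exact pow_le_pow_of_le_one hp0 p.2.2 (Nat.sub_le ℓ 1)
      _ = (p : ℝ) ^ ℓ * apDegree ℓ n p := by rw [apDegree]; ring
  rw [← apDegree] at hother
  linarith

lemma tendsto_apMean (hℓ : ∀ᶠ n in atTop, 2 ≤ ℓ n)
    (hℓn : Tendsto (fun n : ℕ => (ℓ n : ℝ) / n) atTop (𝓝 0))
    (h : Tendsto (fun n => apIntensity (ℓ n) n (p n)) atTop (𝓝 c)) :
    Tendsto (fun n => apMean (ℓ n) n (p n)) atTop (𝓝 (c / 2)) := by
  have hlower := h.mul (hℓn.const_sub 1)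
  rw [sub_zero, mul_one] at hlower
  have htwice : Tendsto (fun n => 2 * apMean (ℓ n) n (p n)) atTop (𝓝 c) := by
    refine tendsto_of_tendsto_of_tendsto_of_le_of_le' hlower h ?_ ?_
    · filter_upwards [hℓ, eventually_gt_atTop 0] with n hn hn0
      exact le_two_mul_apMean hn hn0 (p n).2.1
    · filter_upwards [hℓ] with n hn
      exact two_mul_apMean_le hn (p n).2.1
  exact (htwice.div_const 2).congr fun n => mul_div_cancel_left₀ _ two_ne_zero

lemma tendsto_apDegree_zero (hℓ : ∀ᶠ n in atTop, 2 ≤ ℓ n) (hp : ∀ᶠ n in atTop, (0 : ℝ) < p n)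
    (hnp : Tendsto (fun n : ℕ => (ℓ n : ℝ) ^ 2 / (n * p n)) atTop (𝓝 0))
    (h : Tendsto (fun n => apIntensity (ℓ n) n (p n)) atTop (𝓝 c)) :
    Tendsto (fun n => apDegree (ℓ n) n (p n)) atTop (𝓝 0) := by
  have hlim := (h.mul hnp).const_mul 2
  rw [mul_zero, mul_zero] at hlim
  refine squeeze_zero' (.of_forall fun n => apDegree_nonneg (p n).2.1) ?_ hlim
  filter_upwards [hℓ, hp, eventually_gt_atTop 0] with n hn hpn hn0
  exact apDegree_le hn hn0 hpn

lemma tendsto_charFun_numAP_of_tendsto_zero (hℓ : ∀ᶠ n in atTop, 2 ≤ ℓ n)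
    (h : Tendsto (fun n => apIntensity (ℓ n) n (p n)) atTop (𝓝 0)) (t : ℝ) :
    Tendsto (fun n => charFun ((randomSubset n (p n)).map fun S => (numAP (ℓ n) n S : ℝ)) t)
      atTop (𝓝 1) := by
  rw [tendsto_iff_norm_sub_tendsto_zero]
  have hlim := h.const_mul |t|
  rw [mul_zero] at hlim
  refine squeeze_zero' (.of_forall fun n => norm_nonneg _) ?_ hlim
  filter_upwards [hℓ] with n hn
  have hmean : apMean (ℓ n) n (p n) ≤ apIntensity (ℓ n) n (p n) := by
    have := two_mul_apMean_le (n := n) hn (p n).2.1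
    have := apMean_nonneg (ℓ := ℓ n) (n := n) (p n).2.1
    linarith
  have hmoment := norm_charFun_map_sub_le (integrable_numAP (ℓ n) n (p n))
    (integrable_zero (Set ℕ) ℝ _) t
  simp only [Pi.zero_apply, sub_zero, Nat.abs_cast, integral_numAP] at hmoment
  simpa [Pi.zero_def, charFun_dirac] using
    hmoment.trans (mul_le_mul_of_nonneg_left hmean (abs_nonneg t))

lemma tendsto_charFun_numAP_of_pos (hℓ : ∀ᶠ n in atTop, 3 ≤ ℓ n)
    (hp : Tendsto (fun n => (p n : ℝ)) atTop (𝓝 0)) (hc : 0 < c)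
    (h : Tendsto (fun n => apIntensity (ℓ n) n (p n)) atTop (𝓝 c)) (t : ℝ) :
    Tendsto (fun n => charFun ((randomSubset n (p n)).map fun S => (numAP (ℓ n) n S : ℝ)) t)
      atTop (𝓝 (cexp ((c / 2 : ℝ) * (cexp (t * I) - 1)))) := by
  have hr : (0 : ℝ) < 1 / 2 ∧ (1 / 2 : ℝ) < 1 := by norm_num
  have hℓ2 : ∀ᶠ n in atTop, 2 ≤ ℓ n := hℓ.mono fun n hn => by omega
  have hle := eventually_le_sq_mul_pow hℓ2 (half_pos hc).le
    (h.eventually_const_le (half_lt_self hc))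
  have hp2 := hp.eventually_le_const hr.1
  have hp0 := eventually_pos_of_le_sq_mul_pow (hℓ.mono fun n hn => by omega) (half_pos hc) hle
  have hℓn := tendsto_pow_div_natCast_zero hr.1 hr.2 hp2 (half_pos hc) hle 1
  simp only [pow_one] at hℓn
  have hμ := tendsto_apMean hℓ2 hℓn h
  have hD := tendsto_apDegree_zero hℓ2 hp0
    (tendsto_sq_div_natCast_mul_zero hℓ hr.1 hr.2 hp2 (half_pos hc) hle) h
  obtain ⟨K, hK⟩ := exists_isSparse_apSet hr.1 hr.2
  have herror : Tendsto (fun n => t ^ 2 * Real.exp (2 * apMean (ℓ n) n (p n))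
      * (apMean (ℓ n) n (p n) * (2 * apDegree (ℓ n) n (p n) + p n * K))) atTop (𝓝 0) := by
    simpa using (((Real.continuous_exp.tendsto _).comp (hμ.const_mul 2)).const_mul (t ^ 2)).mul
      (hμ.mul ((hD.const_mul 2).add (hp.mul_const K)))
  have hlim : Tendsto (fun n => cexp (apMean (ℓ n) n (p n) * (cexp (t * I) - 1))) atTop
      (𝓝 (cexp ((c / 2 : ℝ) * (cexp (t * I) - 1)))) :=
    (Complex.continuous_exp.tendsto _).comp
      (((continuous_ofReal.tendsto _).comp hμ).mul_const _)
  refine tendsto_of_tendsto_of_dist hlim ?_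
  refine squeeze_zero' (.of_forall fun n => dist_nonneg) ?_ herror
  filter_upwards [hℓ2, hp2] with n hn hpn
  rw [dist_comm, dist_eq_norm]
  exact norm_charFun_numAP_sub_poisson_le hn (hK _ _ hn) hpn t

theorem tendstoInDistribution_numAP_poisson {c : NNReal} (hℓ : ∀ᶠ n in atTop, 3 ≤ ℓ n)
    (hp : Tendsto (fun n => (p n : ℝ)) atTop (𝓝 0))
    (h : Tendsto (fun n => apIntensity (ℓ n) n (p n)) atTop (𝓝 c)) :
    TendstoInDistribution (fun n => numAP (ℓ n) n) atTop id (fun n => randomSubset n (p n))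
      (poissonMeasure (c / 2)) := by
  have hX (n) : Measurable (numAP (ℓ n) n) := measurable_numAP _ _
  refine tendstoInDistribution_of_isClosedEmbedding Nat.isClosedEmbedding_coe_real
    (fun n => (hX n).aemeasurable) aemeasurable_id ?_
  refine tendstoInDistribution_of_tendsto_charFun
    (fun n => (measurable_from_nat.comp (hX n)).aemeasurable) (by fun_prop) fun t => ?_
  simp only [id_eq]
  rw [charFun_map_cast_poissonMeasure]
  rcases eq_zero_or_pos c with rfl | hc
  · simpa using tendsto_charFun_numAP_of_tendsto_zero (hℓ.mono fun n hn => by omega) h t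
  · simpa using tendsto_charFun_numAP_of_pos hℓ hp (NNReal.coe_pos.2 hc) h t

end PoissonLimit

section NormalLimit

open Complex

lemma tendsto_div_sqrt_pow_three_zero {ι : Type*} {l : Filter ι} {x y z : ι → ℝ}
    (hy : ∀ᶠ i in l, 0 < y i) (hxyz : ∀ᶠ i in l, x i ^ 2 ≤ z i * y i ^ 3)
    (hz : Tendsto z l (𝓝 0)) : Tendsto (fun i => x i / √(y i) ^ 3) l (𝓝 0) := by
  refine tendsto_zero_of_pow two_ne_zero ?_
  refine squeeze_zero' (.of_forall fun i => sq_nonneg _) ?_ hz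
  filter_upwards [hy, hxyz] with i hyi hi
  rwa [div_pow, ← pow_mul, mul_comm 3, pow_mul, Real.sq_sqrt hyi.le, div_le_iff₀ (by positivity)]

variable {ℓ : ℕ → ℕ} {p : ℕ → unitInterval} {r : ℝ}

lemma tendsto_apMean_atTop (hℓ : ∀ᶠ n in atTop, 2 ≤ ℓ n) (hr0 : 0 < r) (hr1 : r < 1)
    (hp : ∀ᶠ n in atTop, (p n : ℝ) ≤ r)
    (h : Tendsto (fun n => apIntensity (ℓ n) n (p n)) atTop atTop) :
    Tendsto (fun n => apMean (ℓ n) n (p n)) atTop atTop := by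
  have hℓn := tendsto_pow_div_natCast_zero hr0 hr1 hp one_pos
    (eventually_le_sq_mul_pow hℓ zero_le_one (h.eventually_ge_atTop 1)) 1
  have hone : Tendsto (fun n : ℕ => 1 - (ℓ n : ℝ) / n) atTop (𝓝 1) := by
    simpa using hℓn.const_sub 1
  have hlower := h.atTop_mul_pos one_pos hone
  refine (tendsto_const_mul_atTop_of_pos two_pos).1 (tendsto_atTop_mono' _ ?_ hlower)
  filter_upwards [hℓ, eventually_gt_atTop 0] with n hn hn0
  exact le_two_mul_apMean hn hn0 (p n).2.1

lemma eventually_apVariance_pos (hℓ : ∀ᶠ n in atTop, 1 ≤ ℓ n) (hr : r < 1)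
    (hp : ∀ᶠ n in atTop, (p n : ℝ) ≤ r)
    (hμ : Tendsto (fun n => apMean (ℓ n) n (p n)) atTop atTop) :
    ∀ᶠ n in atTop, 0 < apVariance (ℓ n) n (p n) := by
  filter_upwards [hℓ, hp, hμ.eventually_gt_atTop 0] with n hn hpn hμn
  exact (mul_pos (by linarith) hμn).trans_le (one_sub_mul_apMean_le_apVariance hn)

lemma tendsto_apMean_div_sqrt_apVariance_pow_three (hℓ : ∀ᶠ n in atTop, 1 ≤ ℓ n) (hr : r < 1)
    (hp : ∀ᶠ n in atTop, (p n : ℝ) ≤ r)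
    (hμ : Tendsto (fun n => apMean (ℓ n) n (p n)) atTop atTop) :
    Tendsto (fun n => apMean (ℓ n) n (p n) / √(apVariance (ℓ n) n (p n)) ^ 3) atTop (𝓝 0) := by
  have hr' : 0 < 1 - r := sub_pos.2 hr
  refine tendsto_div_sqrt_pow_three_zero (eventually_apVariance_pos hℓ hr hp hμ) ?_
    (hμ.const_div_atTop ((1 - r) ^ 3)⁻¹)
  filter_upwards [hℓ, hp, hμ.eventually_gt_atTop 0] with n hn hpn hμn
  have hvar : (1 - r) * apMean (ℓ n) n (p n) ≤ apVariance (ℓ n) n (p n) :=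
    (mul_le_mul_of_nonneg_right (by linarith) hμn.le).trans (one_sub_mul_apMean_le_apVariance hn)
  calc apMean (ℓ n) n (p n) ^ 2
      = ((1 - r) ^ 3)⁻¹ / apMean (ℓ n) n (p n) * ((1 - r) * apMean (ℓ n) n (p n)) ^ 3 := by
        field_simp
    _ ≤ _ := by gcongr

lemma tendsto_apMean_mul_sq_apDegree_div_sqrt_apVariance_pow_three
    (hℓ : ∀ᶠ n in atTop, 2 ≤ ℓ n) (hℓn : Tendsto (fun n : ℕ => (ℓ n : ℝ) / n) atTop (𝓝 0))
    (hr : r < 1) (hp : ∀ᶠ n in atTop, (p n : ℝ) ≤ r)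
    (hp0 : ∀ᶠ n in atTop, (0 : ℝ) < p n)
    (hnp : Tendsto (fun n : ℕ => (ℓ n : ℝ) ^ 2 / (n * p n)) atTop (𝓝 0)) :
    Tendsto (fun n => apMean (ℓ n) n (p n) * apDegree (ℓ n) n (p n) ^ 2
      / √(apVariance (ℓ n) n (p n)) ^ 3) atTop (𝓝 0) := by
  have hr' : 0 < 1 - r := sub_pos.2 hr
  have hz := hnp.const_mul (16 * (16 / (1 - r)) ^ 3)
  rw [mul_zero] at hz
  have hvar : ∀ᶠ n : ℕ in atTop, (n : ℝ) ^ 3 * (p n : ℝ) ^ (2 * ℓ n - 1)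
      ≤ 16 / (1 - r) * apVariance (ℓ n) n (p n) := by
    filter_upwards [hℓ, hp, hℓn.eventually_le_const one_half_pos, eventually_gt_atTop 0]
      with n hn hpn hℓn hn0
    have hn' : (0 : ℝ) < n := by exact_mod_cast hn0
    have h2ℓ : 2 * ℓ n ≤ n := by
      rw [div_le_iff₀ hn'] at hℓn
      exact_mod_cast (by linarith : 2 * (ℓ n : ℝ) ≤ n)
    have hcube : 0 ≤ (n : ℝ) ^ 3 * (p n : ℝ) ^ (2 * ℓ n - 1) :=
      mul_nonneg (by positivity) (pow_nonneg (p n).2.1 _)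
    rw [div_mul_eq_mul_div, le_div_iff₀ hr', mul_comm]
    exact (mul_le_mul_of_nonneg_right (by linarith) hcube).trans
      (one_sub_mul_cube_mul_pow_le_apVariance hn h2ℓ)
  refine tendsto_div_sqrt_pow_three_zero ?_ ?_ hz
  · filter_upwards [hvar, hp0, eventually_gt_atTop 0] with n hn hpn hn0
    exact pos_of_mul_pos_right (lt_of_lt_of_le (by positivity) hn) (by positivity)
  filter_upwards [hℓ, hvar, hp0, eventually_gt_atTop 0] with n hn hvarn hpn hn0
  have hsq := sq_apMean_mul_sq_apDegree_le (n := n) hn hpn.le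
  rw [← le_div_iff₀ (by positivity)] at hsq
  calc _ ≤ _ := hsq
    _ ≤ 16 * (ℓ n : ℝ) ^ 2 * (16 / (1 - r) * apVariance (ℓ n) n (p n)) ^ 3 / (n * p n) := by
      gcongr
    _ = _ := by ring

lemma tendsto_tripleSum_div_sqrt_apVariance_pow_three (hℓ : ∀ᶠ n in atTop, 3 ≤ ℓ n) (hr0 : 0 < r)
    (hr1 : r < 1) (hp : ∀ᶠ n in atTop, (p n : ℝ) ≤ r)
    (h : Tendsto (fun n => apIntensity (ℓ n) n (p n)) atTop atTop) :
    Tendsto (fun n => tripleSum (apSet (ℓ n) n) (p n) / √(apVariance (ℓ n) n (p n)) ^ 3)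
      atTop (𝓝 0) := by
  have hℓ2 : ∀ᶠ n in atTop, 2 ≤ ℓ n := hℓ.mono fun n hn => by omega
  have hℓ1 : ∀ᶠ n in atTop, 1 ≤ ℓ n := hℓ.mono fun n hn => by omega
  have hle := eventually_le_sq_mul_pow hℓ2 zero_le_one (h.eventually_ge_atTop 1)
  have hp0 := eventually_pos_of_le_sq_mul_pow (hℓ.mono fun n hn => by omega) one_pos hle
  have hℓn := tendsto_pow_div_natCast_zero hr0 hr1 hp one_pos hle 1
  simp only [pow_one] at hℓn
  have hmean := tendsto_apMean_div_sqrt_apVariance_pow_three hℓ1 hr1 hp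
    (tendsto_apMean_atTop hℓ2 hr0 hr1 hp h)
  have hdegree := tendsto_apMean_mul_sq_apDegree_div_sqrt_apVariance_pow_three hℓ2 hℓn hr1 hp hp0
    (tendsto_sq_div_natCast_mul_zero hℓ hr0 hr1 hp one_pos hle)
  obtain ⟨C, hC⟩ := exists_tripleSum_apSet_le hr0 hr1
  have hlim := (hdegree.const_mul 2).add (hmean.const_mul (2 * C ^ 2))
  rw [mul_zero, mul_zero, add_zero] at hlim
  refine squeeze_zero' (.of_forall fun n => ?_) ?_ hlim
  · have hpn : (0 : ℝ) ≤ p n := (p n).2.1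
    unfold tripleSum
    positivity
  filter_upwards [hℓ2, hp] with n hn hpn
  have hμ : 0 ≤ apMean (ℓ n) n (p n) := apMean_nonneg (p n).2.1
  calc _ ≤ apMean (ℓ n) n (p n) * (apDegree (ℓ n) n (p n) + C) ^ 2
        / √(apVariance (ℓ n) n (p n)) ^ 3 := by gcongr; exact hC _ _ _ hn (p n).2.1 hpn
    _ ≤ apMean (ℓ n) n (p n) * (2 * (apDegree (ℓ n) n (p n) ^ 2 + C ^ 2))
        / √(apVariance (ℓ n) n (p n)) ^ 3 := by gcongr; exact add_sq_le
    _ = _ := by ring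

lemma numAP_sub_integral_div_eq_sum (ℓ n : ℕ) (p : unitInterval) (σ : ℝ) (S : Set ℕ) :
    ((numAP ℓ n S : ℝ) - ∫ S', (numAP ℓ n S' : ℝ) ∂(randomSubset n p)) / σ
      = ∑ T ∈ apSet ℓ n, centeredInd p T S / σ := by
  rw [integral_numAP, ← sum_apSet_pow_card, numAP_cast, ← Finset.sum_sub_distrib, Finset.sum_div]
  rfl

theorem tendstoInDistribution_numAP_gaussian (hℓ : ∀ᶠ n in atTop, 3 ≤ ℓ n) (hr : r < 1)
    (hp : ∀ᶠ n in atTop, (p n : ℝ) ≤ r)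
    (h : Tendsto (fun n => apIntensity (ℓ n) n (p n)) atTop atTop) :
    TendstoInDistribution (fun n S => ((numAP (ℓ n) n S : ℝ)
        - ∫ S', (numAP (ℓ n) n S' : ℝ) ∂(randomSubset n (p n))) / √(apVariance (ℓ n) n (p n)))
      atTop id (fun n => randomSubset n (p n)) (gaussianReal 0 1) := by
  obtain ⟨s, hrs, hs1⟩ := exists_between (max_lt hr zero_lt_one)
  have hs0 : 0 < s := (le_max_right _ _).trans_lt hrs
  have hps : ∀ᶠ n in atTop, (p n : ℝ) ≤ s :=
    hp.mono fun n hn => hn.trans ((le_max_left _ _).trans hrs.le)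
  have hvar := eventually_apVariance_pos (hℓ.mono fun n hn => by omega) hs1 hps
    (tendsto_apMean_atTop (hℓ.mono fun n hn => by omega) hs0 hs1 hps h)
  refine tendstoInDistribution_of_tendsto_charFun (fun n => ?_) aemeasurable_id fun t => ?_
  · exact (((measurable_from_nat.comp (measurable_numAP _ _)).sub_const _).div_const _).aemeasurable
  have herror := (tendsto_tripleSum_div_sqrt_apVariance_pow_three hℓ hs0 hs1 hps h).const_mul
    (64 * |t| ^ 3)
  rw [mul_zero] at herror
  rw [Measure.map_id, charFun_gaussianReal, tendsto_iff_norm_sub_tendsto_zero]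
  refine squeeze_zero' (.of_forall fun n => norm_nonneg _) ?_ herror
  filter_upwards [hvar] with n hn
  have hbound := norm_charFun_map_sum_containsInd_sub_gaussian_le (p := p n) (F := apSet (ℓ n) n)
    (fun _ => coe_subset_Icc_of_mem_apSet) (Real.sqrt_pos.2 hn)
    (by rw [Real.sq_sqrt hn.le, apVariance]; simp only [numAP_cast]) t
  simp only [numAP_sub_integral_div_eq_sum]
  rw [← mul_div_assoc]
  simpa [neg_div] using hbound

end NormalLimit

end RandomAP

open RandomAP in
theorem theorem1_general (ℓ : ℕ → ℕ) (p : ℕ → unitInterval) (hℓ : ∀ᶠ n in atTop, 3 ≤ ℓ n) :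
    (Tendsto (fun n : ℕ => (p n : ℝ)) atTop (𝓝 0) → ∀ c : NNReal,
      Tendsto (fun n : ℕ => (n : ℝ) ^ 2 * (p n : ℝ) ^ ℓ n / ((ℓ n : ℝ) - 1)) atTop (𝓝 (c : ℝ)) →
      TendstoInDistribution (fun n : ℕ => numAP (ℓ n) n) atTop (id : ℕ → ℕ)
        (fun n : ℕ => randomSubset n (p n)) (poissonMeasure (c / 2))) ∧
    (∀ r : ℝ, r < 1 → (∀ᶠ n in atTop, (p n : ℝ) ≤ r) →
      Tendsto (fun n : ℕ => (n : ℝ) ^ 2 * (p n : ℝ) ^ ℓ n / ((ℓ n : ℝ) - 1)) atTop atTop →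
      TendstoInDistribution
        (fun (n : ℕ) (S : Set ℕ) =>
          ((numAP (ℓ n) n S : ℝ) - ∫ S', (numAP (ℓ n) n S' : ℝ) ∂(randomSubset n (p n)))
            / √(Var[fun S' : Set ℕ => (numAP (ℓ n) n S' : ℝ); randomSubset n (p n)]))
        atTop (id : ℝ → ℝ) (fun n : ℕ => randomSubset n (p n)) (gaussianReal 0 1)) :=
  ⟨fun hp _ h => tendstoInDistribution_numAP_poisson hℓ hp h,
    fun _ hr hp h => tendstoInDistribution_numAP_gaussian hℓ hr hp h⟩

theorem theorem1 (ℓ : ℕ → ℕ) (p : ℕ → unitInterval)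
    (hℓ : (∃ ℓ₀ : ℕ, 3 ≤ ℓ₀ ∧ ∀ n, ℓ n = ℓ₀) ∨
      (Filter.Tendsto ℓ Filter.atTop Filter.atTop ∧
        Filter.Tendsto (fun n : ℕ => (ℓ n : ℝ) / Real.log (n : ℝ)) Filter.atTop (nhds 0)))
    (hp_pos : ∀ n, 0 < p n)
    (hp : Filter.Tendsto (fun n : ℕ => (p n : ℝ)) Filter.atTop (nhds 0)) :
    (∀ c : NNReal,
      Filter.Tendsto (fun n : ℕ => (n : ℝ) ^ 2 * (p n : ℝ) ^ ℓ n / ((ℓ n : ℝ) - 1))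
        Filter.atTop (nhds (c : ℝ)) →
      MeasureTheory.TendstoInDistribution (fun n : ℕ => RandomAP.numAP (ℓ n) n)
        Filter.atTop (id : ℕ → ℕ) (fun n : ℕ => RandomAP.randomSubset n (p n))
        (ProbabilityTheory.poissonMeasure (c / 2))) ∧
    (Filter.Tendsto (fun n : ℕ => (n : ℝ) ^ 2 * (p n : ℝ) ^ ℓ n / ((ℓ n : ℝ) - 1))
        Filter.atTop Filter.atTop →
      MeasureTheory.TendstoInDistribution
        (fun (n : ℕ) (S : Set ℕ) =>
          ((RandomAP.numAP (ℓ n) n S : ℝ)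
              - ∫ S', (RandomAP.numAP (ℓ n) n S' : ℝ) ∂(RandomAP.randomSubset n (p n)))
            / Real.sqrt (ProbabilityTheory.variance
                (fun S' : Set ℕ => (RandomAP.numAP (ℓ n) n S' : ℝ))
                (RandomAP.randomSubset n (p n))))
        Filter.atTop (id : ℝ → ℝ) (fun n : ℕ => RandomAP.randomSubset n (p n))
        (ProbabilityTheory.gaussianReal 0 1)) := by
  have hℓ3 : ∀ᶠ n in atTop, 3 ≤ ℓ n := by
    rcases hℓ with ⟨ℓ₀, hℓ₀, hconst⟩ | ⟨htop, -⟩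
    · exact .of_forall fun n => (hconst n).symm ▸ hℓ₀
    · exact htop.eventually_ge_atTop 3
  obtain ⟨hpoisson, hgaussian⟩ := theorem1_general ℓ p hℓ3
  exact ⟨hpoisson hp, hgaussian (1 / 2) one_half_lt_one (hp.eventually_le_const one_half_pos)⟩
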